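/- Let $\rho$ be a nonzero positive semidefinite and $\sigma$ a positive definite complex $d\times d$ matrix, $d\ge 1$. Logarithms are to base $2$. For $\alpha\neq 1$ and $z>0$ let $$D_{\alpha,z}(\rho\|\sigma)=\frac1{\alpha-1}\log\frac{\operatorname{Tr}\big(\rho^{\alpha/2z}\sigma^{(1-\alpha)/z}\rho^{\alpha/2z}\big)^{z}}{\operatorname{Tr}\rho},\qquad \widehat D_\alpha=D_{\alpha,1-\alpha}\ (\alpha<1).$$ Let $\mu_1\ge\dots\ge\mu_d$ be the eigenvalues of $\rho$ with multiplicity (degeneracies are allowed), choose any orthonormal eigenbasis of $\rho$ in this order, and, for a real $r\neq0$, put $\nu_k=\det\big((\sigma^{-1/r})_{1:k,1:k}\big)^{-r}$, where $X_{1:k,1:k}$ is the leading $k\times k$ block of the matrix of $X$ in that basis. Let $S(\rho)=-\operatorname{Tr}\rho\log\rho$ and $D(\rho\|\tau)=\operatorname{Tr}\rho\log\rho-\operatorname{Tr}\rho\log\tau$. Then, for every real $r\ne0$, as $\alpha\to1$ with $z=r(\alpha-1)>0$ (that is, $\alpha\to1^+$ if $r>0$ and $\alpha\to1^-$ if $r<0$),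 the limit $$L_r(\rho,\sigma)=\lim_{\alpha\to1}D_{\alpha,r(\alpha-1)}(\rho\|\sigma)$$ exists, and, for every choice of the ordered eigenbasis, $$L_r(\rho,\sigma)=\frac1{\operatorname{Tr}\rho}\Big(-S(\rho)-\mu_d\log\det\sigma-\sum_{i=1}^{d-1}(\mu_i-\mu_{i+1})\log\nu_i\Big)=\frac{D(\rho\|\hat\sigma)}{\operatorname{Tr}\rho},$$ where $\hat\sigma$ is the matrix that is diagonal in the chosen eigenbasis with diagonal entries $\nu_1,\nu_2/\nu_1,\dots,\nu_d/\nu_{d-1}$. (The factor $1/\operatorname{Tr}\rho$ is $1$ for density matrices.) In particular, for $r=-1$, $\lim_{\alpha\to1^-}\widehat D_\alpha(\rho\|\sigma)$ is given by this formula with $\nu_k=\det(\sigma_{1:k,1:k})$. The function $L_r$ is jointly continuous in $(\rho,\sigma)$ on the set of all such pairs. It is not necessarily smooth: for every $d\ge2$ and every $r\neq0$ there are a positive definite $\rho_0$ with $\operatorname{Tr}\rho_0=1$, a Hermitian $H$ with $\operatorname{Tr}H=0$ and a positive definite $\sigma$ such that $t\mapsto L_r(\rho_0+tH,\sigma)$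 is not differentiable at $t=0$. -/

import Mathlib

open Filter Topology
open scoped ComplexOrder

namespace RenyiLimit

open Matrix

noncomputable section

/-- The power `A ^ s` of a positive semidefinite matrix, by functional calculus on the spectrum.
The eigenvalue `0` is sent to `0` when `s ≠ 0`. -/
def mpow {d : ℕ} (A : Matrix (Fin d) (Fin d) ℂ) (s : ℝ) : Matrix (Fin d) (Fin d) ℂ :=
  cfc (fun x : ℝ => x ^ s) A

/-- The base-2 logarithm of a positive semidefinite matrix, with `log 0 = 0` on the kernel
(only used in the form `ρ log ρ`, or for positive definite matrices). -/
def mlog {d : ℕ} (A : Matrix (Fin d) (Fin d) ℂ) : Matrix (Fin d) (Fin d) ℂ :=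
  cfc (fun x : ℝ => Real.logb 2 x) A

/-- The trace functional `Tr (ρ^{α/2z} σ^{(1-α)/z} ρ^{α/2z})^z` (used for `z > 0`). -/
def traceFunctional {d : ℕ} (α z : ℝ) (ρ σ : Matrix (Fin d) (Fin d) ℂ) : ℝ :=
  (mpow (mpow ρ (α / (2 * z)) * mpow σ ((1 - α) / z) * mpow ρ (α / (2 * z))) z).trace.re

/-- The `α`-`z`-relative Rényi entropy of a nonzero, not necessarily normalized, `ρ`. -/
def renyi {d : ℕ} (α z : ℝ) (ρ σ : Matrix (Fin d) (Fin d) ℂ) : ℝ :=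
  1 / (α - 1) * Real.logb 2 (traceFunctional α z ρ σ / ρ.trace.re)

/-- The reverse sandwiched relative Rényi entropy. -/
def reverseSandwiched {d : ℕ} (α : ℝ) (ρ σ : Matrix (Fin d) (Fin d) ℂ) : ℝ :=
  1 / (α - 1) * Real.logb 2
    ((mpow (mpow ρ (α / (2 * (1 - α))) * σ * mpow ρ (α / (2 * (1 - α)))) (1 - α)).trace.re
      / ρ.trace.re)

/-- The von Neumann entropy `S(ρ) = -Tr ρ log ρ`. -/
def vonNeumannEntropy {d : ℕ} (ρ : Matrix (Fin d) (Fin d) ℂ) : ℝ :=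
  -(ρ * mlog ρ).trace.re

/-- The quantum relative entropy `D(ρ‖τ) = Tr ρ log ρ - Tr ρ log τ` (`τ` positive definite). -/
def relEntropy {d : ℕ} (ρ τ : Matrix (Fin d) (Fin d) ℂ) : ℝ :=
  (ρ * mlog ρ).trace.re - (ρ * mlog τ).trace.re

/-- The columns of the unitary `U` are an orthonormal eigenbasis of `ρ`, with the eigenvalues
`μ` (with multiplicity) in decreasing order. -/
def IsOrderedEigenbasis {d : ℕ} (ρ U : Matrix (Fin d) (Fin d) ℂ) (μ : Fin d → ℝ) : Prop :=
  U ∈ Matrix.unitaryGroup (Fin d) ℂ ∧ Antitone μ ∧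
    ρ = U * diagonal (fun i => (μ i : ℂ)) * Uᴴ

/-- The leading principal `k × k` minor of the (Hermitian) matrix of `X` in the basis formed by
the columns of `U`; it equals `1` for `k = 0`. -/
def leadingMinor {d : ℕ} (U X : Matrix (Fin d) (Fin d) ℂ) (k : ℕ) : ℝ :=
  ((Uᴴ * X * U).submatrix (Subtype.val : {j : Fin d // (j : ℕ) < k} → Fin d)
    (Subtype.val : {j : Fin d // (j : ℕ) < k} → Fin d)).det.re

/-- `ν_k = det((σ^{-1/r})_{1:k,1:k})^{-r}`, in the basis formed by the columns of `U`. -/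
def nu {d : ℕ} (r : ℝ) (U σ : Matrix (Fin d) (Fin d) ℂ) (k : ℕ) : ℝ :=
  leadingMinor U (mpow σ (-1 / r)) k ^ (-r)

/-- The matrix `diag_ρ(ν_1, ν_2/ν_1, …, ν_d/ν_{d-1})`, diagonal in the basis formed by the
columns of `U`. It is applied to sequences with `ν_0 = 1`. -/
def sigmaHat {d : ℕ} (U : Matrix (Fin d) (Fin d) ℂ) (ν : ℕ → ℝ) : Matrix (Fin d) (Fin d) ℂ :=
  U * diagonal (fun i : Fin d => ((ν ((i : ℕ) + 1) / ν (i : ℕ) : ℝ) : ℂ)) * Uᴴ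

/-- `-S(ρ) - μ_d log det σ - ∑_{i=1}^{d-1} (μ_i - μ_{i+1}) log ν_i`, where `d = n + 1`. -/
def limitFormula {n : ℕ} (ρ σ : Matrix (Fin (n + 1)) (Fin (n + 1)) ℂ)
    (μ : Fin (n + 1) → ℝ) (ν : ℕ → ℝ) : ℝ :=
  -vonNeumannEntropy ρ - μ (Fin.last n) * Real.logb 2 σ.det.re
    - ∑ i : Fin n, (μ i.castSucc - μ i.succ) * Real.logb 2 (ν ((i : ℕ) + 1))

end

end RenyiLimit

/-! With `z = r (α - 1)` the exponent `(1 - α) / z` is the constant `-1 / r`. In an eigenbasis of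
`ρ` the matrix inside the trace is therefore `D T D`, where `T` is the fixed matrix of `σ ^ (-1/r)`
and `D` has diagonal entries `μ i ^ (α / 2z)` with `α / z → ∞`. Its eigenvalues `l i` are accessible
through the coefficients of the characteristic polynomial: the `k`-th elementary symmetric function
of `l` is the sum over `k`-sets `s` of the principal minor of `T` on `s` times `∏ i ∈ s, μ i ^ (α /
z)` (`sum_prod_eigenvalues`).

All minors are positive, so `l i` lies between constant multiples of `μ i ^ (α / z)`, uniformly in
`α` (`exists_bounds`). Hence, for `μ i > 0`, `l i ^ z = μ i ^ α * exp (z * y i)` with `y i` bounded,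
and `∑ l i ^ z = ∑ μ i ^ α + z ∑ μ i * y i + o(z)`. The single `y i` need not be computed: Abel
summation expresses `∑ μ i * y i` through the partial sums `Y k` of `y`, with coefficients `μ k - μ
(k+1)`, so only gaps of the spectrum contribute. At a gap one `k`-set dominates, and `Y k` tends to
the logarithm of the leading minor of `T` (`tendsto_prod_div_prod`). This is why degeneracies and
the choice of eigenbasis do no harm.

Continuity follows by compactness of the unitary group, because the formula holds in whichever
ordered eigenbasis appears in the limit. Smoothness fails where two eigenvalues cross: the ordered
eigenvalues then depend on `|t|`. -/

namespace RenyiLimit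

open Matrix

/-! ### Functional calculus in an ordered eigenbasis -/

theorem conjTranspose_mul_self_of_mem {d : ℕ} {U : Matrix (Fin d) (Fin d) ℂ}
    (hU : U ∈ Matrix.unitaryGroup (Fin d) ℂ) : Uᴴ * U = 1 :=
  (Matrix.mem_unitaryGroup_iff').1 hU

theorem mul_conjTranspose_self_of_mem {d : ℕ} {U : Matrix (Fin d) (Fin d) ℂ}
    (hU : U ∈ Matrix.unitaryGroup (Fin d) ℂ) : U * Uᴴ = 1 :=
  (Matrix.mem_unitaryGroup_iff).1 hU

theorem isHermitian_conj_diagonal {d : ℕ} (U : Matrix (Fin d) (Fin d) ℂ) (μ : Fin d → ℝ) :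
    (U * diagonal (fun i => (μ i : ℂ)) * Uᴴ).IsHermitian :=
  isHermitian_mul_mul_conjTranspose U
    (isHermitian_diagonal_iff.2 fun i => Complex.conj_ofReal (μ i))

/-- The functional calculus acts on the eigenvalues in any diagonalization. -/
theorem cfc_conj_diagonal {d : ℕ} {U : Matrix (Fin d) (Fin d) ℂ}
    (hU : U ∈ Matrix.unitaryGroup (Fin d) ℂ) (μ : Fin d → ℝ) (f : ℝ → ℝ) :
    cfc f (U * diagonal (fun i => (μ i : ℂ)) * Uᴴ) =
      U * diagonal (fun i => (f (μ i) : ℂ)) * Uᴴ := by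
  set A := U * diagonal (fun i => (μ i : ℂ)) * Uᴴ with hAdef
  have hA : A.IsHermitian := isHermitian_conj_diagonal U μ
  have hUU := conjTranspose_mul_self_of_mem hU
  have hUU' := mul_conjTranspose_self_of_mem hU
  set V : Matrix (Fin d) (Fin d) ℂ := hA.eigenvectorUnitary.1 with hV
  have hVm : V ∈ Matrix.unitaryGroup (Fin d) ℂ := hA.eigenvectorUnitary.2
  have hVV := conjTranspose_mul_self_of_mem hVm
  have hVV' := mul_conjTranspose_self_of_mem hVm
  have h1 : A = V * diagonal (fun i => (hA.eigenvalues i : ℂ)) * Vᴴ := by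
    conv_lhs => rw [hA.spectral_theorem]
    rfl
  have h2 : cfc f A = V * diagonal (fun i => (f (hA.eigenvalues i) : ℂ)) * Vᴴ := by
    rw [hA.cfc_eq]
    rfl
  have h3 : diagonal (fun i => (hA.eigenvalues i : ℂ)) * (Vᴴ * U) =
      (Vᴴ * U) * diagonal (fun i => (μ i : ℂ)) := by
    calc _ = (Vᴴ * V) * diagonal (fun i => (hA.eigenvalues i : ℂ)) * Vᴴ * U := by
          rw [hVV, Matrix.one_mul, Matrix.mul_assoc]
      _ = Vᴴ * (V * diagonal (fun i => (hA.eigenvalues i : ℂ)) * Vᴴ) * U := by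
          simp only [Matrix.mul_assoc]
      _ = Vᴴ * (U * diagonal (fun i => (μ i : ℂ)) * Uᴴ) * U := by rw [← h1]
      _ = Vᴴ * U * diagonal (fun i => (μ i : ℂ)) * (Uᴴ * U) := by
          simp only [Matrix.mul_assoc]
      _ = _ := by rw [hUU, Matrix.mul_one]
  -- A nonzero entry of the intertwiner `Vᴴ * U` forces the two eigenvalues it links to coincide, so
  -- it also intertwines their images under `f`.
  have h4 : diagonal (fun i => (f (hA.eigenvalues i) : ℂ)) * (Vᴴ * U) =
      (Vᴴ * U) * diagonal (fun i => (f (μ i) : ℂ)) := by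
    ext i j
    have h := congrFun (congrFun h3 i) j
    rw [diagonal_mul, mul_diagonal] at h ⊢
    by_cases hW : (Vᴴ * U) i j = 0
    · simp [hW]
    · rw [mul_comm] at h
      have : hA.eigenvalues i = μ j := by exact_mod_cast mul_left_cancel₀ hW h
      rw [this, mul_comm]
  rw [h2]
  calc _ = V * diagonal (fun i => (f (hA.eigenvalues i) : ℂ)) * Vᴴ * (U * Uᴴ) := by
        rw [hUU', Matrix.mul_one]
    _ = V * (diagonal (fun i => (f (hA.eigenvalues i) : ℂ)) * (Vᴴ * U)) * Uᴴ := by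
        simp only [Matrix.mul_assoc]
    _ = (V * Vᴴ) * U * diagonal (fun i => (f (μ i) : ℂ)) * Uᴴ := by
        rw [h4]; simp only [Matrix.mul_assoc]
    _ = _ := by rw [hVV', Matrix.one_mul]

theorem exists_isOrderedEigenbasis {d : ℕ} {A : Matrix (Fin d) (Fin d) ℂ} (hA : A.IsHermitian) :
    ∃ U μ, IsOrderedEigenbasis A U μ := by
  set V : Matrix (Fin d) (Fin d) ℂ := hA.eigenvectorUnitary.1 with hV
  have hVm : V ∈ Matrix.unitaryGroup (Fin d) ℂ := hA.eigenvectorUnitary.2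
  have h1 : A = V * diagonal (fun i => (hA.eigenvalues i : ℂ)) * Vᴴ := by
    conv_lhs => rw [hA.spectral_theorem]
    rfl
  let e := Tuple.sort (fun i => -hA.eigenvalues i)
  have he : Antitone (hA.eigenvalues ∘ e) := fun i j hij => by
    have := Tuple.monotone_sort (fun i => -hA.eigenvalues i) hij
    simpa using this
  refine ⟨V.submatrix id e, hA.eigenvalues ∘ e, ?_, he, ?_⟩
  · rw [Matrix.mem_unitaryGroup_iff, Matrix.star_eq_conjTranspose, conjTranspose_submatrix,
      submatrix_mul_equiv, mul_conjTranspose_self_of_mem hVm, submatrix_id_id]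
  · have : diagonal (fun i => (((hA.eigenvalues ∘ e) i : ℝ) : ℂ)) =
        (diagonal (fun i => (hA.eigenvalues i : ℂ))).submatrix e e := by
      rw [submatrix_diagonal_equiv]; rfl
    rw [this, conjTranspose_submatrix, submatrix_mul_equiv, submatrix_mul_equiv, submatrix_id_id]
    exact h1

namespace IsOrderedEigenbasis

variable {d : ℕ} {A U : Matrix (Fin d) (Fin d) ℂ} {μ : Fin d → ℝ}

theorem cfc_eq (h : IsOrderedEigenbasis A U μ) (f : ℝ → ℝ) :
    cfc f A = U * diagonal (fun i => (f (μ i) : ℂ)) * Uᴴ := by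
  conv_lhs => rw [h.2.2]
  exact cfc_conj_diagonal h.1 μ f

theorem diagonal_eq (h : IsOrderedEigenbasis A U μ) :
    Uᴴ * A * U = diagonal (fun i => (μ i : ℂ)) := by
  have hUU := conjTranspose_mul_self_of_mem h.1
  calc Uᴴ * A * U = (Uᴴ * U) * diagonal (fun i => (μ i : ℂ)) * (Uᴴ * U) := by
        conv_lhs => rw [h.2.2]
        simp only [Matrix.mul_assoc]
    _ = _ := by rw [hUU, Matrix.one_mul, Matrix.mul_one]

theorem eigenvalue_eq (h : IsOrderedEigenbasis A U μ) (i : Fin d) :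
    μ i = ((Uᴴ * A * U) i i).re := by
  rw [h.diagonal_eq]; simp

theorem nonneg (h : IsOrderedEigenbasis A U μ) (hA : A.PosSemidef) (i : Fin d) : 0 ≤ μ i := by
  have h1 : (Uᴴ * A * U).PosSemidef := hA.conjTranspose_mul_mul_same U
  rw [h.diagonal_eq, posSemidef_diagonal_iff] at h1
  exact_mod_cast h1 i

theorem pos (h : IsOrderedEigenbasis A U μ) (hA : A.PosDef) (i : Fin d) : 0 < μ i := by
  have h1 : (Uᴴ * A * U).PosDef := by
    refine hA.conjTranspose_mul_mul_same ?_
    refine Matrix.mulVec_injective_of_isUnit ?_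
    exact IsUnit.of_mul_eq_one Uᴴ (mul_conjTranspose_self_of_mem h.1)
  rw [h.diagonal_eq, posDef_diagonal_iff] at h1
  exact_mod_cast h1 i

theorem trace_cfc (h : IsOrderedEigenbasis A U μ) (f : ℝ → ℝ) :
    (cfc f A).trace = ((∑ i, f (μ i) : ℝ) : ℂ) := by
  rw [h.cfc_eq, Matrix.trace_mul_comm, ← Matrix.mul_assoc, conjTranspose_mul_self_of_mem h.1,
    Matrix.one_mul, trace_diagonal]
  push_cast; rfl

theorem trace_eq (h : IsOrderedEigenbasis A U μ) : A.trace = ((∑ i, μ i : ℝ) : ℂ) := by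
  conv_lhs => rw [h.2.2]
  rw [Matrix.trace_mul_comm, ← Matrix.mul_assoc, conjTranspose_mul_self_of_mem h.1,
    Matrix.one_mul, trace_diagonal]
  push_cast; rfl

theorem charpoly_eq (h : IsOrderedEigenbasis A U μ) :
    A.charpoly = (diagonal (fun i => (μ i : ℂ))).charpoly := by
  conv_lhs => rw [h.2.2]
  rw [charpoly_mul_comm, ← Matrix.mul_assoc, conjTranspose_mul_self_of_mem h.1, Matrix.one_mul]

theorem det_eq (h : IsOrderedEigenbasis A U μ) : A.det = ((∏ i, μ i : ℝ) : ℂ) := by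
  conv_lhs => rw [h.2.2]
  rw [Matrix.det_mul_comm, ← Matrix.mul_assoc, conjTranspose_mul_self_of_mem h.1, Matrix.one_mul,
    det_diagonal]
  push_cast; rfl

end IsOrderedEigenbasis

theorem posDef_conj_diagonal {d : ℕ} {U : Matrix (Fin d) (Fin d) ℂ}
    (hU : U ∈ Matrix.unitaryGroup (Fin d) ℂ) {μ : Fin d → ℝ} (hμ : ∀ i, 0 < μ i) :
    (U * diagonal (fun i => (μ i : ℂ)) * Uᴴ).PosDef := by
  refine PosDef.mul_mul_conjTranspose_same ?_ ?_
  · rw [posDef_diagonal_iff]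
    exact fun i => by exact_mod_cast hμ i
  · exact Matrix.vecMul_injective_of_isUnit
      (IsUnit.of_mul_eq_one Uᴴ (mul_conjTranspose_self_of_mem hU))

/-! ### Powers and leading minors of positive definite matrices -/

theorem posDef_mpow {d : ℕ} {A : Matrix (Fin d) (Fin d) ℂ} (hA : A.PosDef) (s : ℝ) :
    (mpow A s).PosDef := by
  obtain ⟨U, μ, h⟩ := exists_isOrderedEigenbasis hA.1
  rw [mpow, h.cfc_eq]
  exact posDef_conj_diagonal h.1 fun i => Real.rpow_pos_of_pos (h.pos hA i) s

theorem mpow_mpow {d : ℕ} {A : Matrix (Fin d) (Fin d) ℂ} (hA : A.PosDef) (s t : ℝ) :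
    mpow (mpow A s) t = mpow A (s * t) := by
  obtain ⟨U, μ, h⟩ := exists_isOrderedEigenbasis hA.1
  rw [mpow, mpow, mpow, h.cfc_eq, h.cfc_eq, cfc_conj_diagonal h.1 (fun i => μ i ^ s)]
  simp_rw [Real.rpow_mul (h.pos hA _).le]

theorem mpow_one {d : ℕ} {A : Matrix (Fin d) (Fin d) ℂ} (hA : A.IsHermitian) :
    mpow A 1 = A := by
  simp only [mpow, Real.rpow_one]
  exact cfc_id' ℝ A

theorem det_mpow {d : ℕ} {A : Matrix (Fin d) (Fin d) ℂ} (hA : A.PosDef) (s : ℝ) :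
    (mpow A s).det.re = A.det.re ^ s := by
  obtain ⟨U, μ, h⟩ := exists_isOrderedEigenbasis hA.1
  rw [h.det_eq, mpow, h.cfc_eq, Matrix.det_mul_comm, ← Matrix.mul_assoc,
    conjTranspose_mul_self_of_mem h.1, Matrix.one_mul, det_diagonal, Complex.ofReal_re,
    ← Real.finsetProd_rpow _ _ fun i _ => (h.pos hA i).le, ← Complex.ofReal_prod,
    Complex.ofReal_re]

theorem posDef_conj {d : ℕ} {A U : Matrix (Fin d) (Fin d) ℂ} (hA : A.PosDef)
    (hU : U ∈ Matrix.unitaryGroup (Fin d) ℂ) : (Uᴴ * A * U).PosDef :=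
  hA.conjTranspose_mul_mul_same (Matrix.mulVec_injective_of_isUnit
    (IsUnit.of_mul_eq_one Uᴴ (mul_conjTranspose_self_of_mem hU)))

theorem leadingMinor_pos {d : ℕ} {U A : Matrix (Fin d) (Fin d) ℂ} (hA : A.PosDef)
    (hU : U ∈ Matrix.unitaryGroup (Fin d) ℂ) (k : ℕ) : 0 < leadingMinor U A k :=
  (Complex.lt_def.1 ((posDef_conj hA hU).submatrix Subtype.val_injective).det_pos).1

theorem leadingMinor_zero {d : ℕ} (U A : Matrix (Fin d) (Fin d) ℂ) : leadingMinor U A 0 = 1 := by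
  have : IsEmpty {j : Fin d // (j : ℕ) < 0} := ⟨fun j => by simpa using j.2⟩
  simp [leadingMinor]

theorem leadingMinor_eq_det {d : ℕ} {U : Matrix (Fin d) (Fin d) ℂ}
    (hU : U ∈ Matrix.unitaryGroup (Fin d) ℂ) (A : Matrix (Fin d) (Fin d) ℂ) :
    leadingMinor U A d = A.det.re := by
  have h := Matrix.det_submatrix_equiv_self
    (Equiv.subtypeUnivEquiv (p := fun j : Fin d => (j : ℕ) < d) fun j => j.2) (Uᴴ * A * U)
  rw [Matrix.det_mul_comm, ← Matrix.mul_assoc, mul_conjTranspose_self_of_mem hU,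
    Matrix.one_mul] at h
  rw [← h]; rfl

/-! ### Symmetric functions of eigenvalues through principal minors -/

/-- Matrices with the same characteristic polynomial have the same sums of principal minors. -/
theorem sum_minors_eq_of_charpoly_eq {ι R : Type*} [Fintype ι] [DecidableEq ι] [CommRing R]
    {A B : Matrix ι ι R} (h : A.charpoly = B.charpoly) (k : ℕ) :
    ∑ s ∈ Finset.univ.powersetCard k, (A.submatrix (Subtype.val : s → ι) Subtype.val).det =
      ∑ s ∈ Finset.univ.powersetCard k, (B.submatrix (Subtype.val : s → ι) Subtype.val).det := by
  by_cases hk : k ≤ Fintype.card ι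
  · have hA := charpoly_coeff_eq_sum_minors A k hk
    rw [h, charpoly_coeff_eq_sum_minors B k hk] at hA
    have h1 : ((-1 : R) ^ k) * (-1) ^ k = 1 := by rw [← mul_pow]; simp
    have := congrArg (fun x => (-1 : R) ^ k * x) hA
    simpa only [← mul_assoc, h1, one_mul] using this.symm
  · rw [Finset.powersetCard_eq_empty.2 (by simpa using hk)]; simp

/-- The principal minor of `T` with index set `s`. -/
noncomputable def principalMinor {d : ℕ} (T : Matrix (Fin d) (Fin d) ℂ) (s : Finset (Fin d)) : ℝ :=
  (T.submatrix (Subtype.val : s → Fin d) Subtype.val).det.re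

theorem principalMinor_pos {d : ℕ} {T : Matrix (Fin d) (Fin d) ℂ} (hT : T.PosDef)
    (s : Finset (Fin d)) : 0 < principalMinor T s :=
  (Complex.lt_def.1 (hT.submatrix Subtype.val_injective).det_pos).1

theorem ofReal_principalMinor {d : ℕ} {T : Matrix (Fin d) (Fin d) ℂ} (hT : T.PosDef)
    (s : Finset (Fin d)) : (principalMinor T s : ℂ) =
      (T.submatrix (Subtype.val : s → Fin d) Subtype.val).det := by
  have h := (Complex.lt_def.1 (hT.submatrix (Subtype.val_injective (p := (· ∈ s)))).det_pos).2
  refine Complex.ext rfl ?_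
  simpa using h

theorem principalMinor_initial {d : ℕ} (U A : Matrix (Fin d) (Fin d) ℂ) (k : ℕ) :
    principalMinor (Uᴴ * A * U) (Finset.univ.filter fun j : Fin d => (j : ℕ) < k) =
      leadingMinor U A k := by
  exact congrArg Complex.re (Matrix.det_submatrix_equiv_self
    (Equiv.subtypeEquivRight (p := fun j : Fin d => (j : ℕ) < k)
      (q := fun j => j ∈ Finset.univ.filter fun j : Fin d => (j : ℕ) < k) (by simp))
    ((Uᴴ * A * U).submatrix Subtype.val Subtype.val)).symm

/-- Elementary symmetric functions of the eigenvalues of `D T D`, with `D` diagonal. -/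
theorem sum_prod_eigenvalues {d : ℕ} {U T X V : Matrix (Fin d) (Fin d) ℂ} (hT : T.PosDef)
    (hU : U ∈ Matrix.unitaryGroup (Fin d) ℂ) {a l : Fin d → ℝ}
    (hX : X = U * (diagonal (fun i => (a i : ℂ)) * T * diagonal (fun i => (a i : ℂ))) * Uᴴ)
    (hl : IsOrderedEigenbasis X V l) (k : ℕ) :
    ∑ s ∈ Finset.univ.powersetCard k, ∏ i ∈ s, l i =
      ∑ s ∈ Finset.univ.powersetCard k, principalMinor T s * ∏ i ∈ s, a i ^ 2 := by
  have h1 := hl.charpoly_eq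
  rw [hX, charpoly_mul_comm, ← Matrix.mul_assoc, conjTranspose_mul_self_of_mem hU,
    Matrix.one_mul] at h1
  have h2 := sum_minors_eq_of_charpoly_eq h1 k
  apply Complex.ofReal_injective
  push_cast
  refine Eq.trans ?_ (h2.symm.trans ?_)
  · refine Finset.sum_congr rfl fun s _ => ?_
    rw [submatrix_diagonal _ _ Subtype.val_injective, det_diagonal]
    exact (Finset.prod_coe_sort s fun i => (l i : ℂ)).symm
  · refine Finset.sum_congr rfl fun s _ => ?_
    have : (diagonal (fun i => (a i : ℂ)) * T * diagonal (fun i => (a i : ℂ))).submatrix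
        (Subtype.val : s → Fin d) Subtype.val =
        diagonal (fun i : s => (a i : ℂ)) * T.submatrix (Subtype.val : s → Fin d) Subtype.val *
          diagonal (fun i : s => (a i : ℂ)) := by
      ext i j
      simp [diagonal_mul, mul_diagonal]
    rw [this, det_mul, det_mul, det_diagonal, ofReal_principalMinor hT,
      Finset.prod_coe_sort s fun i => (a i : ℂ), Finset.prod_pow]
    ring

/-! ### Eigenvalue bounds from symmetric functions -/

/-- The set of the first `k` indices. -/
abbrev initialSet (d k : ℕ) : Finset (Fin d) := Finset.univ.filter fun j : Fin d => (j : ℕ) < k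

theorem card_initialSet {d k : ℕ} (hk : k ≤ d) : (initialSet d k).card = k := by
  rw [Fin.card_filter_val_lt, min_eq_right hk]

theorem initialSet_succ {d : ℕ} (i : Fin d) :
    initialSet d ((i : ℕ) + 1) = insert i (initialSet d i) := by
  ext j
  simp only [Finset.mem_filter, Finset.mem_univ, true_and, Finset.mem_insert, Fin.ext_iff]
  omega

theorem prod_initialSet_succ {d : ℕ} (f : Fin d → ℝ) (i : Fin d) :
    ∏ j ∈ initialSet d ((i : ℕ) + 1), f j = f i * ∏ j ∈ initialSet d i, f j := by
  rw [initialSet_succ, Finset.prod_insert (by simp)]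

theorem prod_initialSet_zero {d : ℕ} (f : Fin d → ℝ) : ∏ j ∈ initialSet d 0, f j = 1 := by
  simp [initialSet]

/-- Exchange argument: after cancelling the common factors, `s \ t` and `t \ s` have equally many
factors, separated by the threshold `a`. -/
theorem prod_le_prod_of_threshold {ι : Type*} [DecidableEq ι] {f : ι → ℝ} (hf : ∀ i, 0 ≤ f i)
    {s t : Finset ι} (hst : s.card = t.card) {a : ℝ} (ha : 0 ≤ a) (ht : ∀ i ∈ t, a ≤ f i)
    (hs : ∀ i ∉ t, f i ≤ a) : ∏ i ∈ s, f i ≤ ∏ i ∈ t, f i := by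
  rw [← Finset.prod_inter_mul_prod_sdiff s t f, ← Finset.prod_inter_mul_prod_sdiff t s f,
    Finset.inter_comm t s]
  have hc : (s \ t).card = (t \ s).card := Finset.card_sdiff_comm hst
  refine mul_le_mul_of_nonneg_left ?_ (Finset.prod_nonneg fun i _ => hf i)
  calc ∏ i ∈ s \ t, f i ≤ ∏ i ∈ s \ t, a :=
        Finset.prod_le_prod (fun i _ => hf i) fun i hi => hs i (Finset.mem_sdiff.1 hi).2
    _ = ∏ i ∈ t \ s, a := by rw [Finset.prod_const, Finset.prod_const, hc]
    _ ≤ _ := Finset.prod_le_prod (fun i _ => ha) fun i hi => ht i (Finset.mem_sdiff.1 hi).1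

theorem prod_lt_prod_of_threshold {ι : Type*} [DecidableEq ι] {f : ι → ℝ} (hf : ∀ i, 0 ≤ f i)
    {s t : Finset ι} (hst : s.card = t.card) (hne : s ≠ t) {a b : ℝ} (hb : 0 ≤ b) (hab : b < a)
    (ht : ∀ i ∈ t, a ≤ f i) (hs : ∀ i ∉ t, f i ≤ b) : ∏ i ∈ s, f i < ∏ i ∈ t, f i := by
  rw [← Finset.prod_inter_mul_prod_sdiff s t f, ← Finset.prod_inter_mul_prod_sdiff t s f,
    Finset.inter_comm t s]
  have hc : (s \ t).card = (t \ s).card := Finset.card_sdiff_comm hst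
  -- Strictness of `b ^ m < a ^ m` requires at least one exchanged factor.
  have h0 : (t \ s).card ≠ 0 := by
    rw [← hc, Finset.card_ne_zero, Finset.sdiff_nonempty]
    exact fun h => hne (Finset.eq_of_subset_of_card_le h hst.ge)
  refine mul_lt_mul_of_pos_left ?_
    (Finset.prod_pos fun i hi => (hb.trans_lt hab).trans_le (ht i (Finset.mem_inter.1 hi).2))
  calc ∏ i ∈ s \ t, f i ≤ ∏ i ∈ s \ t, b :=
        Finset.prod_le_prod (fun i _ => hf i) fun i hi => hs i (Finset.mem_sdiff.1 hi).2
    _ = b ^ (t \ s).card := by rw [Finset.prod_const, hc]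
    _ < a ^ (t \ s).card := pow_lt_pow_left₀ hab hb h0
    _ = ∏ i ∈ t \ s, a := by rw [Finset.prod_const]
    _ ≤ _ := Finset.prod_le_prod (fun i _ => hb.trans hab.le)
        fun i hi => ht i (Finset.mem_sdiff.1 hi).1

theorem prod_le_prod_initialSet {d : ℕ} {f : Fin d → ℝ} (hf : ∀ i, 0 ≤ f i) (hanti : Antitone f)
    (s : Finset (Fin d)) : ∏ i ∈ s, f i ≤ ∏ i ∈ initialSet d s.card, f i := by
  have hk : s.card ≤ d := by simpa using s.card_le_univ
  rcases Nat.eq_zero_or_pos s.card with h0 | h0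
  · rw [h0, prod_initialSet_zero, Finset.card_eq_zero.1 h0, Finset.prod_empty]
  · refine prod_le_prod_of_threshold hf (card_initialSet hk).symm (a := f ⟨s.card - 1, by omega⟩)
      (hf _) (fun i hi => hanti ?_) (fun i hi => hanti ?_)
    · have := (Finset.mem_filter.1 hi).2
      exact Fin.le_def.2 (by simp only; omega)
    · have : ¬ (i : ℕ) < s.card := fun h => hi (by simp [h])
      exact Fin.le_def.2 (by simp only; omega)

/-- Weighted and unweighted elementary symmetric functions agree. -/
def SymmAgree {d : ℕ} (w : Finset (Fin d) → ℝ) (l q : Fin d → ℝ) : Prop :=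
  ∀ k, ∑ s ∈ Finset.univ.powersetCard k, ∏ i ∈ s, l i =
    ∑ s ∈ Finset.univ.powersetCard k, w s * ∏ i ∈ s, q i

/-- For nonnegative decreasing sequences the initial product is the largest term of the symmetric
function, so both sides of `SymmAgree` are comparable to their initial terms. The constants depend
on `w` alone, which later gives uniformity in `α`. -/
theorem exists_prod_bounds {d : ℕ} {w : Finset (Fin d) → ℝ} (hw : ∀ s, 0 < w s) :
    ∃ c C : ℝ, 0 < c ∧ 0 < C ∧ ∀ l q : Fin d → ℝ, (∀ i, 0 ≤ l i) → (∀ i, 0 ≤ q i) →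
      Antitone l → Antitone q → SymmAgree w l q → ∀ k ≤ d,
      c * ∏ i ∈ initialSet d k, q i ≤ ∏ i ∈ initialSet d k, l i ∧
      ∏ i ∈ initialSet d k, l i ≤ C * ∏ i ∈ initialSet d k, q i := by
  obtain ⟨s₀, -, hs₀⟩ := Finset.exists_min_image Finset.univ w ⟨∅, Finset.mem_univ _⟩
  have hN : (0 : ℝ) < Fintype.card (Finset (Fin d)) := by
    exact_mod_cast Fintype.card_pos
  -- The smallest weight divided by the number of all subsets, and the total weight: crude, but
  -- independent of `k`.
  refine ⟨w s₀ / Fintype.card (Finset (Fin d)), ∑ s, w s, div_pos (hw _) hN,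
    Finset.sum_pos (fun s _ => hw s) ⟨∅, Finset.mem_univ _⟩, ?_⟩
  intro l q hl hq hla hqa h k hk
  have hmem : initialSet d k ∈ (Finset.univ : Finset (Fin d)).powersetCard k :=
    Finset.mem_powersetCard.2 ⟨Finset.subset_univ _, card_initialSet hk⟩
  have hln : ∀ s : Finset (Fin d), 0 ≤ ∏ i ∈ s, l i := fun s => Finset.prod_nonneg fun i _ => hl i
  have hqn : ∀ s : Finset (Fin d), 0 ≤ ∏ i ∈ s, q i := fun s => Finset.prod_nonneg fun i _ => hq i
  constructor
  · rw [div_mul_eq_mul_div, div_le_iff₀ hN]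
    calc w s₀ * ∏ i ∈ initialSet d k, q i
        ≤ w (initialSet d k) * ∏ i ∈ initialSet d k, q i :=
          mul_le_mul_of_nonneg_right (hs₀ _ (Finset.mem_univ _)) (hqn _)
      _ ≤ ∑ s ∈ Finset.univ.powersetCard k, w s * ∏ i ∈ s, q i :=
          Finset.single_le_sum (f := fun s => w s * ∏ i ∈ s, q i)
            (fun s _ => mul_nonneg (hw s).le (hqn s)) hmem
      _ = ∑ s ∈ Finset.univ.powersetCard k, ∏ i ∈ s, l i := (h k).symm
      _ ≤ ∑ s ∈ (Finset.univ : Finset (Fin d)).powersetCard k, ∏ i ∈ initialSet d k, l i :=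
          Finset.sum_le_sum fun s hs => by
            have := prod_le_prod_initialSet hl hla s
            rwa [(Finset.mem_powersetCard.1 hs).2] at this
      _ ≤ ∑ s : Finset (Fin d), ∏ i ∈ initialSet d k, l i :=
          Finset.sum_le_sum_of_subset_of_nonneg (Finset.subset_univ _) fun _ _ _ => hln _
      _ = _ := by rw [Finset.sum_const, nsmul_eq_mul, mul_comm, Finset.card_univ]
  · calc ∏ i ∈ initialSet d k, l i ≤ ∑ s ∈ Finset.univ.powersetCard k, ∏ i ∈ s, l i :=
          Finset.single_le_sum (f := fun s => ∏ i ∈ s, l i) (fun s _ => hln s) hmem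
      _ = ∑ s ∈ Finset.univ.powersetCard k, w s * ∏ i ∈ s, q i := h k
      _ ≤ ∑ s ∈ Finset.univ.powersetCard k, w s * ∏ i ∈ initialSet d k, q i :=
          Finset.sum_le_sum fun s hs => by
            have := prod_le_prod_initialSet hq hqa s
            rw [(Finset.mem_powersetCard.1 hs).2] at this
            exact mul_le_mul_of_nonneg_left this (hw s).le
      _ ≤ ∑ s, w s * ∏ i ∈ initialSet d k, q i :=
          Finset.sum_le_sum_of_subset_of_nonneg (Finset.subset_univ _)
            fun s _ _ => mul_nonneg (hw s).le (hqn _)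
      _ = _ := by rw [Finset.sum_mul]

/-- Quotients of consecutive initial products isolate a single index. If the initial product
vanishes there is nothing to divide by, but then monotonicity makes the next entry zero. -/
theorem exists_bounds {d : ℕ} {w : Finset (Fin d) → ℝ} (hw : ∀ s, 0 < w s) :
    ∃ c C : ℝ, 0 < c ∧ 0 < C ∧ ∀ l q : Fin d → ℝ, (∀ i, 0 ≤ l i) → (∀ i, 0 ≤ q i) →
      Antitone l → Antitone q → SymmAgree w l q → ∀ i, c * q i ≤ l i ∧ l i ≤ C * q i := by
  obtain ⟨c, C, hc, hC, h⟩ := exists_prod_bounds hw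
  refine ⟨c / C, C / c, div_pos hc hC, div_pos hC hc, ?_⟩
  intro l q hl hq hla hqa hlq i
  have h1 := h l q hl hq hla hqa hlq i i.2.le
  have h2 := h l q hl hq hla hqa hlq (i + 1) i.2
  rw [prod_initialSet_succ, prod_initialSet_succ] at h2
  have hzero : ∀ f : Fin d → ℝ, (∀ i, 0 ≤ f i) → Antitone f →
      ¬ 0 < ∏ j ∈ initialSet d i, f j → f i = 0 := by
    intro f hf hfa hP
    have h0 : ∏ j ∈ initialSet d i, f j = 0 :=
      le_antisymm (not_lt.1 hP) (Finset.prod_nonneg fun j _ => hf j)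
    obtain ⟨j, hj, hj0⟩ := Finset.prod_eq_zero_iff.1 h0
    have : j ≤ i := Fin.le_def.2 (Finset.mem_filter.1 hj).2.le
    exact le_antisymm (hj0 ▸ hfa this) (hf i)
  constructor
  · by_cases hQ : 0 < ∏ j ∈ initialSet d i, q j
    · rw [div_mul_eq_mul_div, div_le_iff₀ hC]
      refine le_of_mul_le_mul_right ?_ hQ
      calc c * q i * ∏ j ∈ initialSet d i, q j = c * (q i * ∏ j ∈ initialSet d i, q j) := by ring
        _ ≤ l i * ∏ j ∈ initialSet d i, l j := h2.1
        _ ≤ l i * (C * ∏ j ∈ initialSet d i, q j) := mul_le_mul_of_nonneg_left h1.2 (hl i)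
        _ = _ := by ring
    · rw [hzero q hq hqa hQ, mul_zero]
      exact hl i
  · by_cases hP : 0 < ∏ j ∈ initialSet d i, l j
    · rw [div_mul_eq_mul_div, le_div_iff₀ hc]
      refine le_of_mul_le_mul_right ?_ hP
      calc l i * c * ∏ j ∈ initialSet d i, l j = c * (l i * ∏ j ∈ initialSet d i, l j) := by ring
        _ ≤ c * (C * (q i * ∏ j ∈ initialSet d i, q j)) := mul_le_mul_of_nonneg_left h2.2 hc.le
        _ = C * q i * (c * ∏ j ∈ initialSet d i, q j) := by ring
        _ ≤ C * q i * ∏ j ∈ initialSet d i, l j :=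
            mul_le_mul_of_nonneg_left h1.1 (mul_nonneg hC.le (hq i))
    · rw [hzero l hl hla hP]
      exact mul_nonneg (div_pos hC hc).le (hq i)

/-! ### Asymptotics at spectral gaps and the first-order expansion -/

/-- At a gap of `μ`, the product of the leading `l i` is asymptotic to that of the leading
`μ i ^ s`, up to the leading weight. -/
theorem tendsto_prod_div_prod {β : Type*} {F : Filter β} {d : ℕ} {w : Finset (Fin d) → ℝ}
    (hw : ∀ s, 0 < w s) {μ : Fin d → ℝ} (hμ : ∀ i, 0 ≤ μ i) (hμa : Antitone μ)
    {s : β → ℝ} (hs : Tendsto s F atTop) {l : β → Fin d → ℝ}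
    (hl : ∀ᶠ x in F, (∀ i, 0 ≤ l x i) ∧ Antitone (l x) ∧ SymmAgree w (l x) fun i => μ i ^ s x)
    {k : ℕ} (hk : k ≤ d) {a b : ℝ} (hb : 0 ≤ b) (hab : b < a)
    (ha : ∀ i : Fin d, (i : ℕ) < k → a ≤ μ i) (hb' : ∀ i : Fin d, k ≤ (i : ℕ) → μ i ≤ b) :
    Tendsto (fun x => (∏ i ∈ initialSet d k, l x i) / ∏ i ∈ initialSet d k, μ i ^ s x) F
      (𝓝 (w (initialSet d k))) := by
  obtain ⟨c, C, hc, hC, hcC⟩ := exists_bounds hw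
  set t₀ := initialSet d k with ht₀
  have hmem : t₀ ∈ (Finset.univ : Finset (Fin d)).powersetCard k :=
    Finset.mem_powersetCard.2 ⟨Finset.subset_univ _, card_initialSet hk⟩
  have hat : ∀ i ∈ t₀, a ≤ μ i := fun i hi => ha i (Finset.mem_filter.1 hi).2
  have hpos : 0 < ∏ i ∈ t₀, μ i :=
    Finset.prod_pos fun i hi => (hb.trans_lt hab).trans_le (hat i hi)
  have hQpos : ∀ x, 0 < ∏ i ∈ t₀, μ i ^ s x := fun x => Finset.prod_pos fun i hi =>
    Real.rpow_pos_of_pos ((hb.trans_lt hab).trans_le (hat i hi)) _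
  -- Because of the gap, `t₀` is the unique maximizer of `∏ μ i` among `k`-sets; the ratio is a base
  -- below `1` raised to `s x → ∞`.
  have hq0 : ∀ t ∈ ((Finset.univ : Finset (Fin d)).powersetCard k).erase t₀,
      Tendsto (fun x => (∏ i ∈ t, μ i ^ s x) / ∏ i ∈ t₀, μ i ^ s x) F (𝓝 0) := by
    intro t ht
    obtain ⟨htne, ht⟩ := Finset.mem_erase.1 ht
    have hlt : ∏ i ∈ t, μ i < ∏ i ∈ t₀, μ i := by
      refine prod_lt_prod_of_threshold hμ ?_ htne hb hab hat fun i hi => hb' i ?_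
      · rw [(Finset.mem_powersetCard.1 ht).2, card_initialSet hk]
      · by_contra hlt
        exact hi (by simp [ht₀, not_le.1 hlt])
    have h0 : 0 ≤ ∏ i ∈ t, μ i := Finset.prod_nonneg fun i _ => hμ i
    have h1 : Tendsto (fun x => ((∏ i ∈ t, μ i) / ∏ i ∈ t₀, μ i) ^ s x) F (𝓝 0) :=
      (tendsto_rpow_atTop_of_base_lt_one _ (by linarith [div_nonneg h0 hpos.le])
        ((div_lt_one hpos).2 hlt)).comp hs
    refine h1.congr fun x => ?_
    rw [Real.div_rpow h0 hpos.le, Real.finsetProd_rpow _ _ fun i _ => hμ i,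
      Real.finsetProd_rpow _ _ fun i _ => hμ i]
  -- The bound `l i ≤ C * μ i ^ s` transfers the decay to products of eigenvalues.
  have hl0 : ∀ t ∈ ((Finset.univ : Finset (Fin d)).powersetCard k).erase t₀,
      Tendsto (fun x => (∏ i ∈ t, l x i) / ∏ i ∈ t₀, μ i ^ s x) F (𝓝 0) := by
    intro t ht
    have h1 := (hq0 t ht).const_mul (C ^ t.card)
    rw [mul_zero] at h1
    refine tendsto_of_tendsto_of_tendsto_of_le_of_le' tendsto_const_nhds h1 ?_ ?_
    · filter_upwards [hl] with x hx
      exact div_nonneg (Finset.prod_nonneg fun i _ => hx.1 i) (hQpos x).le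
    · filter_upwards [hl, hs.eventually_ge_atTop 0] with x hx hsx
      rw [← mul_div_assoc]
      refine div_le_div_of_nonneg_right ?_ (hQpos x).le
      rw [← Finset.prod_const, ← Finset.prod_mul_distrib]
      refine Finset.prod_le_prod (fun i _ => hx.1 i) fun i _ => ?_
      exact (hcC (l x) _ hx.1 (fun i => Real.rpow_nonneg (hμ i) _) hx.2.1
        (fun i j hij => Real.rpow_le_rpow (hμ j) (hμa hij) hsx) hx.2.2 i).2
  have h1 := (tendsto_finsetSum _ fun t ht => (hq0 t ht).const_mul (w t)).sub
    (tendsto_finsetSum _ hl0)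
  have h2 := h1.const_add (w t₀)
  simp only [mul_zero, Finset.sum_const_zero, sub_zero, add_zero] at h2
  refine h2.congr' ?_
  filter_upwards [hl] with x hx
  have h3 := hx.2.2 k
  -- Isolating `t₀` on both sides and dividing by its product leaves `w t₀` plus terms that tend to
  -- zero.
  rw [← Finset.add_sum_erase _ _ hmem, ← Finset.add_sum_erase _ _ hmem] at h3
  have hQ := (hQpos x).ne'
  simp only [← mul_div_assoc, ← Finset.sum_div]
  field_simp
  linarith

/-- Abel summation. It moves the differences from `Y` to `μ`, so that indices inside a degenerate
block get coefficient zero. -/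
theorem sum_mul_sub_eq {n : ℕ} (μ : Fin (n + 1) → ℝ) (Y : ℕ → ℝ) (hY : Y 0 = 0) :
    ∑ i : Fin (n + 1), μ i * (Y ((i : ℕ) + 1) - Y i) =
      μ (Fin.last n) * Y (n + 1) +
        ∑ i : Fin n, (μ i.castSucc - μ i.succ) * Y ((i : ℕ) + 1) := by
  have h1 : ∑ i : Fin (n + 1), μ i * Y ((i : ℕ) + 1) =
      ∑ i : Fin n, μ i.castSucc * Y ((i : ℕ) + 1) + μ (Fin.last n) * Y (n + 1) := by
    rw [Fin.sum_univ_castSucc]; simp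
  have h2 : ∑ i : Fin (n + 1), μ i * Y i = ∑ i : Fin n, μ i.succ * Y ((i : ℕ) + 1) := by
    rw [Fin.sum_univ_succ]; simp [hY]
  simp only [mul_sub, sub_mul, Finset.sum_sub_distrib, h1, h2]
  ring

/-- Here `y` is only bounded, not convergent, so the statement compares with `m * y x` rather than
giving a limit. The error is controlled by `|exp u - 1 - u| ≤ u ^ 2` for `|u| ≤ 1`, with `u = z *
y`. -/
theorem tendsto_rpow_mul_exp_sub_div {β : Type*} {F : Filter β} {m : ℝ} (hm : 0 < m)
    {α z y : β → ℝ} (hα : Tendsto α F (𝓝 1)) (hz : Tendsto z F (𝓝 0)) (hz0 : ∀ᶠ x in F, 0 < z x)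
    {B : ℝ} (hy : ∀ᶠ x in F, |y x| ≤ B) :
    Tendsto (fun x => (m ^ α x * Real.exp (z x * y x) - m ^ α x) / z x - m * y x) F (𝓝 0) := by
  have hmα : Tendsto (fun x => m ^ α x) F (𝓝 m) := by
    simpa using tendsto_const_nhds.rpow hα (Or.inl hm.ne')
  have hlim : Tendsto (fun x => m ^ α x * (z x * B ^ 2) + |m ^ α x - m| * B) F (𝓝 0) := by
    have h1 := hmα.mul (hz.mul_const (B ^ 2))
    have h2 := ((hmα.sub_const m).abs).mul_const B
    simpa using h1.add h2
  refine squeeze_zero_norm' ?_ hlim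
  have hzB : ∀ᶠ x in F, z x * B < 1 := by
    have := hz.mul_const B
    rw [zero_mul] at this
    exact this.eventually_lt_const one_pos
  filter_upwards [hz0, hy, hzB] with x hzx hyx hzBx
  have hB : 0 ≤ B := (abs_nonneg _).trans hyx
  have hmx : 0 < m ^ α x := Real.rpow_pos_of_pos hm _
  have habs : |z x * y x| ≤ z x * B := by
    rw [abs_mul, abs_of_pos hzx]
    exact mul_le_mul_of_nonneg_left hyx hzx.le
  have hexp : |(Real.exp (z x * y x) - 1 - z x * y x) / z x| ≤ z x * B ^ 2 := by
    rw [abs_div, abs_of_pos hzx, div_le_iff₀ hzx]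
    calc _ ≤ (z x * y x) ^ 2 := Real.abs_exp_sub_one_sub_id_le (habs.trans hzBx.le)
      _ = |z x * y x| ^ 2 := (sq_abs _).symm
      _ ≤ (z x * B) ^ 2 := pow_le_pow_left₀ (abs_nonneg _) habs 2
      _ = _ := by ring
  have heq : (m ^ α x * Real.exp (z x * y x) - m ^ α x) / z x - m * y x =
      m ^ α x * ((Real.exp (z x * y x) - 1 - z x * y x) / z x) + (m ^ α x - m) * y x := by
    field_simp
    ring
  rw [heq, Real.norm_eq_abs]
  calc _ ≤ |m ^ α x * ((Real.exp (z x * y x) - 1 - z x * y x) / z x)| + |(m ^ α x - m) * y x| :=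
        abs_add_le _ _
    _ ≤ _ := by
        rw [abs_mul, abs_mul, abs_of_pos hmx]
        gcongr

/-- First order expansion of `∑ (l i) ^ z` for `z → 0`, where `l i` is comparable to
`(μ i) ^ (α / z)`. -/
theorem tendsto_sum_rpow_sub_div {β : Type*} {F : Filter β} {n : ℕ}
    {w : Finset (Fin (n + 1)) → ℝ} (hw : ∀ s, 0 < w s)
    {μ : Fin (n + 1) → ℝ} (hμ : ∀ i, 0 ≤ μ i) (hμa : Antitone μ)
    {α z : β → ℝ} (hα : Tendsto α F (𝓝 1)) (hz : Tendsto z F (𝓝 0)) (hz0 : ∀ᶠ x in F, 0 < z x)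
    {l : β → Fin (n + 1) → ℝ}
    (hl : ∀ᶠ x in F, (∀ i, 0 ≤ l x i) ∧ Antitone (l x) ∧
      SymmAgree w (l x) fun i => μ i ^ (α x / z x)) :
    Tendsto (fun x => ((∑ i, l x i ^ z x) - ∑ i, μ i ^ α x) / z x) F
      (𝓝 (μ (Fin.last n) * Real.log (w (initialSet (n + 1) (n + 1))) +
        ∑ i : Fin n, (μ i.castSucc - μ i.succ) *
          Real.log (w (initialSet (n + 1) ((i : ℕ) + 1))))) := by
  obtain ⟨c, C, hc, hC, hcC⟩ := exists_bounds hw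
  have hα0 : ∀ᶠ x in F, 0 < α x := hα.eventually_const_lt one_pos
  have hs : Tendsto (fun x => α x / z x) F atTop := by
    have hz' : Tendsto z F (𝓝[>] 0) := tendsto_nhdsWithin_iff.2 ⟨hz, hz0⟩
    simpa only [div_eq_mul_inv, Pi.inv_apply] using hα.pos_mul_atTop one_pos hz'.inv_tendsto_nhdsGT_zero
  have hbd : ∀ᶠ x in F, ∀ i, c * μ i ^ (α x / z x) ≤ l x i ∧ l x i ≤ C * μ i ^ (α x / z x) := by
    filter_upwards [hl, hs.eventually_ge_atTop 0] with x hx hsx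
    exact hcC (l x) _ hx.1 (fun i => Real.rpow_nonneg (hμ i) _) hx.2.1
      (fun i j hij => Real.rpow_le_rpow (hμ j) (hμa hij) hsx) hx.2.2
  have hzero : ∀ i, μ i = 0 → ∀ᶠ x in F, l x i = 0 := by
    intro i hi
    filter_upwards [hbd, hs.eventually_gt_atTop 0] with x hx hsx
    have := hx i
    rw [hi, Real.zero_rpow hsx.ne', mul_zero, mul_zero] at this
    exact le_antisymm this.2 this.1
  have hlpos : ∀ i, 0 < μ i → ∀ᶠ x in F, 0 < l x i := by
    intro i hi
    filter_upwards [hbd] with x hx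
    exact (mul_pos hc (Real.rpow_pos_of_pos hi _)).trans_le (hx i).1
  let y : β → Fin (n + 1) → ℝ := fun x i => Real.log (l x i / μ i ^ (α x / z x))
  let Y : β → ℕ → ℝ := fun x k => Real.log ((∏ i ∈ initialSet (n + 1) k, l x i) /
    ∏ i ∈ initialSet (n + 1) k, μ i ^ (α x / z x))
  have hterm : ∀ i, Tendsto (fun x => (l x i ^ z x - μ i ^ α x) / z x - μ i * y x i) F (𝓝 0) := by
    intro i
    rcases (hμ i).eq_or_lt with hi | hi
    · refine tendsto_const_nhds.congr' ?_
      filter_upwards [hzero i hi.symm, hz0, hα0] with x hx hzx hαx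
      rw [hx, ← hi, Real.zero_rpow hzx.ne', Real.zero_rpow hαx.ne']
      simp
    · have hy : ∀ᶠ x in F, |y x i| ≤ max |Real.log c| |Real.log C| := by
        filter_upwards [hbd] with x hx
        have hq := Real.rpow_pos_of_pos hi (α x / z x)
        have h1 : c ≤ l x i / μ i ^ (α x / z x) := (le_div_iff₀ hq).2 (hx i).1
        have h2 : l x i / μ i ^ (α x / z x) ≤ C := (div_le_iff₀ hq).2 (hx i).2
        refine abs_le_max_abs_abs (Real.log_le_log hc h1) (Real.log_le_log (hc.trans_le h1) h2)
      refine (tendsto_rpow_mul_exp_sub_div hi hα hz hz0 hy).congr' ?_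
      filter_upwards [hlpos i hi, hz0] with x hx hzx
      have hq := Real.rpow_pos_of_pos hi (α x / z x)
      have : l x i ^ z x = μ i ^ α x * Real.exp (z x * y x i) := by
        have h1 : l x i = μ i ^ (α x / z x) * Real.exp (y x i) := by
          rw [Real.exp_log (div_pos hx hq)]
          field_simp
        rw [h1, Real.mul_rpow hq.le (Real.exp_pos _).le, ← Real.rpow_mul (hμ i),
          div_mul_cancel₀ _ hzx.ne', ← Real.exp_mul, mul_comm (z x)]
      rw [this]
  have hY0 : ∀ x, Y x 0 = 0 := fun x => by
    simp only [Y, prod_initialSet_zero, div_one, Real.log_one]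
  -- For `μ i > 0` all earlier factors are positive too, and the logarithms telescope. For `μ i = 0`
  -- the value of `log` at zero is irrelevant, as it is multiplied by `μ i`.
  have hYy : ∀ᶠ x in F, ∀ i, μ i * y x i = μ i * (Y x ((i : ℕ) + 1) - Y x i) := by
    rw [eventually_all]
    intro i
    rcases (hμ i).eq_or_lt with hi | hi
    · simp [← hi]
    · have hpos : ∀ᶠ x in F, ∀ j ∈ initialSet (n + 1) i, 0 < l x j := by
        rw [Filter.eventually_all_finset]
        intro j hj
        exact hlpos j (hi.trans_le (hμa (Fin.le_def.2 (Finset.mem_filter.1 hj).2.le)))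
      filter_upwards [hpos, hlpos i hi] with x hx hxi
      have hP : 0 < ∏ j ∈ initialSet (n + 1) i, l x j := Finset.prod_pos hx
      have hQ : 0 < ∏ j ∈ initialSet (n + 1) i, μ j ^ (α x / z x) :=
        Finset.prod_pos fun j hj => Real.rpow_pos_of_pos
          (hi.trans_le (hμa (Fin.le_def.2 (Finset.mem_filter.1 hj).2.le))) _
      have hq := Real.rpow_pos_of_pos hi (α x / z x)
      simp only [Y, y]
      rw [prod_initialSet_succ, prod_initialSet_succ, mul_div_mul_comm,
        Real.log_mul (div_pos hxi hq).ne' (div_pos hP hQ).ne', add_sub_cancel_right]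
  have hlimY : ∀ k ≤ n + 1, ∀ a b : ℝ, 0 ≤ b → b < a →
      (∀ i : Fin (n + 1), (i : ℕ) < k → a ≤ μ i) → (∀ i : Fin (n + 1), k ≤ (i : ℕ) → μ i ≤ b) →
      Tendsto (fun x => Y x k) F (𝓝 (Real.log (w (initialSet (n + 1) k)))) := by
    intro k hk a b hb hab h1 h2
    exact (tendsto_prod_div_prod hw hμ hμa hs hl hk hb hab h1 h2).log (hw _).ne'
  have hsumY : Tendsto (fun x => μ (Fin.last n) * Y x (n + 1) +
      ∑ i : Fin n, (μ i.castSucc - μ i.succ) * Y x ((i : ℕ) + 1)) F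
      (𝓝 (μ (Fin.last n) * Real.log (w (initialSet (n + 1) (n + 1))) +
        ∑ i : Fin n, (μ i.castSucc - μ i.succ) *
          Real.log (w (initialSet (n + 1) ((i : ℕ) + 1))))) := by
    refine Tendsto.add ?_ (tendsto_finsetSum _ fun i _ => ?_)
    -- For the full product the gap is the one between `μ (Fin.last n)` and `0`; no index lies
    -- beyond it.
    · rcases (hμ (Fin.last n)).eq_or_lt with hi | hi
      · simp [← hi, tendsto_const_nhds]
      · refine (hlimY (n + 1) le_rfl _ 0 le_rfl hi (fun i _ => hμa (Fin.le_last i)) ?_).const_mul _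
        intro i hi
        exact absurd i.2 (not_lt.2 hi)
    -- Without a gap the coefficient is zero, and the limit of `Y` at this index is not needed.
    · rcases (hμa i.castSucc_lt_succ.le).eq_or_lt with hi | hi
      · simp [hi, tendsto_const_nhds]
      · refine (hlimY (i + 1) (by omega) _ _ (hμ i.succ) hi (fun j hj => hμa ?_)
          (fun j hj => hμa ?_)).const_mul _
        · exact Fin.le_def.2 (by simp only [Fin.val_castSucc]; omega)
        · exact Fin.le_def.2 (by simp only [Fin.val_succ]; omega)
  have h1 := (tendsto_finsetSum Finset.univ fun i _ => hterm i).add hsumY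
  simp only [Finset.sum_const_zero, zero_add] at h1
  refine h1.congr' ?_
  filter_upwards [hYy] with x hx
  rw [← sum_mul_sub_eq μ (Y x) (hY0 x), ← Finset.sum_congr rfl fun i _ => hx i,
    ← Finset.sum_add_distrib, ← Finset.sum_sub_distrib, Finset.sum_div]
  exact Finset.sum_congr rfl fun i _ => by ring

/-! ### From the expansion to the Rényi limit -/

theorem tendsto_rpow_sub_div {m : ℝ} (hm : 0 ≤ m) :
    Tendsto (fun α : ℝ => (m ^ α - m) / (α - 1)) (𝓝[≠] 1) (𝓝 (m * Real.log m)) := by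
  rcases hm.eq_or_lt with rfl | hm
  · refine (tendsto_const_nhds (x := (0 : ℝ))).congr' ?_ |>.trans (by simp)
    have : ∀ᶠ α : ℝ in 𝓝[≠] 1, 0 < α := nhdsWithin_le_nhds (lt_mem_nhds one_pos)
    filter_upwards [this] with α hα
    simp [Real.zero_rpow hα.ne']
  · have h := (Real.hasStrictDerivAt_const_rpow hm 1).hasDerivAt.tendsto_slope
    rw [Real.rpow_one] at h
    refine h.congr fun α => ?_
    rw [slope_def_field, Real.rpow_one]

/-- The chain rule for `log` at `t`. Since `z = 0` at `α = 1`, the value `f 1` carries no meaning in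
the application; it is overwritten by `t` so that the limit becomes a derivative within `S`. -/
theorem tendsto_log_div_of_tendsto {f : ℝ → ℝ} {S : Set ℝ} (hS : (1 : ℝ) ∉ S) {t G : ℝ}
    (ht : 0 < t) (h : Tendsto (fun x => (f x - t) / (x - 1)) (𝓝[S] 1) (𝓝 G)) :
    Tendsto (fun x => 1 / (x - 1) * Real.logb 2 (f x / t)) (𝓝[S] 1)
      (𝓝 (G / t / Real.log 2)) := by
  have hne : ∀ᶠ x in 𝓝[S] (1 : ℝ), x ≠ 1 :=
    eventually_mem_nhdsWithin.mono fun x hx h1 => hS (h1 ▸ hx)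
  have h1 : HasDerivWithinAt (Function.update f 1 t) G S 1 := by
    rw [hasDerivWithinAt_iff_tendsto_slope' hS]
    refine h.congr' ?_
    filter_upwards [hne] with x hx
    rw [slope_def_field, Function.update_of_ne hx, Function.update_self]
  have h2 := h1.log (by rw [Function.update_self]; exact ht.ne')
  rw [hasDerivWithinAt_iff_tendsto_slope' hS, Function.update_self] at h2
  have h3 : Tendsto f (𝓝[S] 1) (𝓝 t) := by
    have := h1.continuousWithinAt.tendsto
    rw [Function.update_self] at this
    refine this.congr' ?_
    filter_upwards [hne] with x hx
    rw [Function.update_of_ne hx]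
  refine (h2.div_const (Real.log 2)).congr' ?_
  filter_upwards [hne, h3.eventually_const_lt ht] with x hx hfx
  rw [slope_def_field, Function.update_of_ne hx, Function.update_self,
    Real.logb, Real.log_div hfx.ne' ht.ne']
  ring

theorem traceFunctional_eq {d : ℕ} {α z : ℝ} {ρ σ V X : Matrix (Fin d) (Fin d) ℂ}
    {l : Fin d → ℝ}
    (hX : X = mpow ρ (α / (2 * z)) * mpow σ ((1 - α) / z) * mpow ρ (α / (2 * z)))
    (hl : IsOrderedEigenbasis X V l) : traceFunctional α z ρ σ = ∑ i, l i ^ z := by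
  rw [traceFunctional, ← hX, mpow, hl.trace_cfc, Complex.ofReal_re]

theorem sandwich_eq {d : ℕ} {ρ U : Matrix (Fin d) (Fin d) ℂ} {μ : Fin d → ℝ}
    (h : IsOrderedEigenbasis ρ U μ) (T : Matrix (Fin d) (Fin d) ℂ) (s : ℝ) :
    mpow ρ s * T * mpow ρ s = U * (diagonal (fun i => ((μ i ^ s : ℝ) : ℂ)) * (Uᴴ * T * U) *
      diagonal (fun i => ((μ i ^ s : ℝ) : ℂ))) * Uᴴ := by
  rw [mpow, h.cfc_eq]
  simp only [Matrix.mul_assoc]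

theorem vonNeumannEntropy_eq {d : ℕ} {ρ U : Matrix (Fin d) (Fin d) ℂ} {μ : Fin d → ℝ}
    (h : IsOrderedEigenbasis ρ U μ) :
    vonNeumannEntropy ρ = -∑ i, μ i * Real.logb 2 (μ i) := by
  have h1 : ρ * mlog ρ = cfc (fun x : ℝ => x * Real.logb 2 x) ρ := by
    rw [mlog, h.cfc_eq, h.cfc_eq]
    conv_lhs => rw [h.2.2]
    calc _ = U * diagonal (fun i => (μ i : ℂ)) * (Uᴴ * U) *
          diagonal (fun i => ((Real.logb 2 (μ i) : ℝ) : ℂ)) * Uᴴ := by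
          simp only [Matrix.mul_assoc]
      _ = _ := by
          rw [conjTranspose_mul_self_of_mem h.1, Matrix.mul_one, Matrix.mul_assoc U,
            diagonal_mul_diagonal]
          push_cast; rfl
  rw [vonNeumannEntropy, h1, h.trace_cfc, Complex.ofReal_re]

theorem trace_pos {d : ℕ} {ρ : Matrix (Fin d) (Fin d) ℂ} (hρ : ρ.PosSemidef) (h0 : ρ ≠ 0) :
    0 < ρ.trace.re := by
  have h1 := Complex.le_def.1 hρ.trace_nonneg
  refine lt_of_le_of_ne h1.1 fun h => h0 ?_
  exact hρ.trace_eq_zero_iff.1 (Complex.ext h.symm h1.2.symm)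

theorem nu_pos {d : ℕ} {U σ : Matrix (Fin d) (Fin d) ℂ} (hσ : σ.PosDef)
    (hU : U ∈ Matrix.unitaryGroup (Fin d) ℂ) (r : ℝ) (k : ℕ) : 0 < nu r U σ k :=
  Real.rpow_pos_of_pos (leadingMinor_pos (posDef_mpow hσ _) hU k) _

theorem nu_zero {d : ℕ} (r : ℝ) (U σ : Matrix (Fin d) (Fin d) ℂ) : nu r U σ 0 = 1 := by
  rw [nu, leadingMinor_zero, Real.one_rpow]

theorem logb_nu {d : ℕ} {U σ : Matrix (Fin d) (Fin d) ℂ} (hσ : σ.PosDef)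
    (hU : U ∈ Matrix.unitaryGroup (Fin d) ℂ) (r : ℝ) (k : ℕ) :
    Real.logb 2 (nu r U σ k) = -r * Real.logb 2 (leadingMinor U (mpow σ (-1 / r)) k) := by
  rw [nu, Real.logb_rpow_eq_mul_logb_of_pos (leadingMinor_pos (posDef_mpow hσ _) hU k)]

theorem nu_eq_det {d : ℕ} {U σ : Matrix (Fin d) (Fin d) ℂ} (hσ : σ.PosDef)
    (hU : U ∈ Matrix.unitaryGroup (Fin d) ℂ) {r : ℝ} (hr : r ≠ 0) : nu r U σ d = σ.det.re := by
  have hdet : 0 < σ.det.re := (Complex.lt_def.1 hσ.det_pos).1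
  rw [nu, leadingMinor_eq_det hU, det_mpow hσ, ← Real.rpow_mul hdet.le,
    show -1 / r * -r = 1 by field_simp, Real.rpow_one]

/-- The limit of the `α`-`z` relative entropies in terms of an ordered eigenbasis. -/
theorem tendsto_renyi {n : ℕ} {r : ℝ} (hr : r ≠ 0) {ρ σ U : Matrix (Fin (n + 1)) (Fin (n + 1)) ℂ}
    {μ : Fin (n + 1) → ℝ} (hρ : ρ.PosSemidef) (h0 : ρ ≠ 0) (hσ : σ.PosDef)
    (h : IsOrderedEigenbasis ρ U μ) :
    Tendsto (fun α : ℝ => renyi α (r * (α - 1)) ρ σ) (𝓝[{α : ℝ | 0 < r * (α - 1)}] 1)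
      (𝓝 (limitFormula ρ σ μ (nu r U σ) / ρ.trace.re)) := by
  set S : Set ℝ := {α : ℝ | 0 < r * (α - 1)} with hS
  set T := Uᴴ * mpow σ (-1 / r) * U with hTdef
  have hT : T.PosDef := posDef_conj (posDef_mpow hσ _) h.1
  have hμ := h.nonneg hρ
  have htr := trace_pos hρ h0
  have htr' : ρ.trace.re = ∑ i, μ i := by rw [h.trace_eq, Complex.ofReal_re]
  have h1S : (1 : ℝ) ∉ S := by simp [hS]
  have hα : Tendsto (fun α : ℝ => α) (𝓝[S] 1) (𝓝 1) := nhdsWithin_le_nhds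
  have hz : Tendsto (fun α : ℝ => r * (α - 1)) (𝓝[S] 1) (𝓝 0) := by
    have : Tendsto (fun α : ℝ => r * (α - 1)) (𝓝[S] 1) (𝓝 (r * (1 - 1))) :=
      (hα.sub_const 1).const_mul r
    simpa using this
  have hz0 : ∀ᶠ α in 𝓝[S] (1 : ℝ), 0 < r * (α - 1) := eventually_mem_nhdsWithin
  let X : ℝ → Matrix (Fin (n + 1)) (Fin (n + 1)) ℂ := fun α =>
    mpow ρ (α / (2 * (r * (α - 1)))) * mpow σ ((1 - α) / (r * (α - 1))) *
      mpow ρ (α / (2 * (r * (α - 1))))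
  have hXps : ∀ α, (X α).PosSemidef := by
    intro α
    have h1 : (mpow ρ (α / (2 * (r * (α - 1))))).IsHermitian := by
      rw [mpow, h.cfc_eq]; exact isHermitian_conj_diagonal _ _
    have := (posDef_mpow hσ ((1 - α) / (r * (α - 1)))).posSemidef.mul_mul_conjTranspose_same
      (mpow ρ (α / (2 * (r * (α - 1)))))
    rwa [h1.eq] at this
  choose V l hl using fun α => exists_isOrderedEigenbasis (hXps α).1
  have hF : ∀ α, traceFunctional α (r * (α - 1)) ρ σ = ∑ i, l α i ^ (r * (α - 1)) := fun α =>
    traceFunctional_eq rfl (hl α)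
  have hev : ∀ᶠ α in 𝓝[S] (1 : ℝ), (∀ i, 0 ≤ l α i) ∧ Antitone (l α) ∧
      SymmAgree (principalMinor T) (l α) fun i => μ i ^ (α / (r * (α - 1))) := by
    filter_upwards [hz0] with α hzα
    refine ⟨(hl α).nonneg (hXps α), (hl α).2.1, fun k => ?_⟩
    -- The exponent of `σ` does not depend on `α`, so one matrix `T`, and one set of weights, serves
    -- all `α`.
    have hne : α - 1 ≠ 0 := fun h => by simp [h] at hzα
    have he : (1 - α) / (r * (α - 1)) = -1 / r := by
      field_simp
      ring
    have hX : X α = _ := sandwich_eq h (mpow σ ((1 - α) / (r * (α - 1)))) (α / (2 * (r * (α - 1))))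
    rw [he] at hX
    rw [sum_prod_eigenvalues hT h.1 hX (hl α) k]
    refine Finset.sum_congr rfl fun s _ => ?_
    congr 1
    refine Finset.prod_congr rfl fun i _ => ?_
    rw [← Real.rpow_mul_natCast (hμ i)]
    congr 1
    push_cast
    field_simp
  have key := tendsto_sum_rpow_sub_div (principalMinor_pos hT) hμ h.2.1 hα hz hz0 hev
  have hsub : 𝓝[S] (1 : ℝ) ≤ 𝓝[≠] 1 := nhdsWithin_mono _ fun x hx h1 => h1S (h1 ▸ hx)
  -- The difference quotient of the trace splits into that of `∑ μ i ^ α`, which yields the entropy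
  -- term, and `r` times the expansion in `z`, since `1 / (α - 1) = r / z`.
  have key2 := (tendsto_finsetSum Finset.univ fun i _ =>
    (tendsto_rpow_sub_div (hμ i)).mono_left hsub).add (key.const_mul r)
  have key3 := tendsto_log_div_of_tendsto (f := fun α => traceFunctional α (r * (α - 1)) ρ σ) h1S htr
    (key2.congr' (by
      filter_upwards [hz0] with α hzα
      have hne : α - 1 ≠ 0 := fun h => by simp [h] at hzα
      rw [hF, htr', ← Finset.sum_div, Finset.sum_sub_distrib]
      field_simp
      ring))
  refine (key3.congr fun α => rfl).trans (le_of_eq ?_)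
  congr 1
  rw [limitFormula, vonNeumannEntropy_eq h, neg_neg, ← nu_eq_det hσ h.1 hr]
  simp only [logb_nu hσ h.1, hTdef, principalMinor_initial]
  rw [div_right_comm]
  congr 1
  simp only [Real.logb]
  rw [add_div, Finset.sum_div, mul_add, add_div, sub_eq_add_neg, sub_eq_add_neg, add_assoc,
    ← Finset.sum_neg_distrib, Finset.mul_sum, Finset.sum_div]
  congr 1
  · exact Finset.sum_congr rfl fun i _ => by ring
  · congr 1
    · ring
    · exact Finset.sum_congr rfl fun i _ => by ring

/-! ### The limit as a relative entropy -/

theorem relEntropy_sigmaHat {n : ℕ} {ρ U : Matrix (Fin (n + 1)) (Fin (n + 1)) ℂ}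
    {μ : Fin (n + 1) → ℝ} (h : IsOrderedEigenbasis ρ U μ) {ν : ℕ → ℝ} (hν : ∀ k, 0 < ν k) :
    relEntropy ρ (sigmaHat U ν) = ∑ i, μ i * Real.logb 2 (μ i) -
      ∑ i, μ i * (Real.logb 2 (ν ((i : ℕ) + 1)) - Real.logb 2 (ν i)) := by
  have h1 : (ρ * mlog (sigmaHat U ν)).trace =
      ((∑ i, μ i * (Real.logb 2 (ν ((i : ℕ) + 1)) - Real.logb 2 (ν i)) : ℝ) : ℂ) := by
    rw [mlog, sigmaHat, cfc_conj_diagonal h.1 (fun i => ν ((i : ℕ) + 1) / ν i)]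
    conv_lhs => rw [h.2.2]
    calc _ = (U * (diagonal (fun i => (μ i : ℂ)) * (Uᴴ * U) *
          diagonal (fun i : Fin (n + 1) => ((Real.logb 2 (ν ((i : ℕ) + 1) / ν i) : ℝ) : ℂ))) * Uᴴ).trace := by
          simp only [Matrix.mul_assoc]
      _ = _ := by
          rw [Matrix.trace_mul_comm, ← Matrix.mul_assoc, conjTranspose_mul_self_of_mem h.1,
            Matrix.one_mul, Matrix.mul_one, diagonal_mul_diagonal, trace_diagonal]
          push_cast
          refine Finset.sum_congr rfl fun i _ => ?_
          rw [Real.logb_div (hν _).ne' (hν _).ne']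
          push_cast; rfl
  have h2 := vonNeumannEntropy_eq h
  rw [vonNeumannEntropy, neg_inj] at h2
  rw [relEntropy, h1, h2, Complex.ofReal_re]

/-- Abel summation once more, now with `Y k = log ν_k`; the boundary values are `ν_0 = 1` and `ν_d =
det σ`. -/
theorem limitFormula_eq_relEntropy {n : ℕ} {r : ℝ} (hr : r ≠ 0)
    {ρ σ U : Matrix (Fin (n + 1)) (Fin (n + 1)) ℂ} {μ : Fin (n + 1) → ℝ} (hσ : σ.PosDef)
    (h : IsOrderedEigenbasis ρ U μ) :
    limitFormula ρ σ μ (nu r U σ) = relEntropy ρ (sigmaHat U (nu r U σ)) := by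
  rw [relEntropy_sigmaHat h (nu_pos hσ h.1 r), limitFormula, vonNeumannEntropy_eq h,
    neg_neg, ← nu_eq_det hσ h.1 hr,
    sum_mul_sub_eq μ (fun k => Real.logb 2 (nu r U σ k)) (by simp [nu_zero])]
  ring

/-! ### Joint continuity by compactness -/

theorem isCompact_unitaryGroup (d : ℕ) :
    IsCompact (Matrix.unitaryGroup (Fin d) ℂ : Set (Matrix (Fin d) (Fin d) ℂ)) := by
  have hK : IsCompact (Set.univ.pi fun _ : Fin d => Set.univ.pi fun _ : Fin d =>
      Metric.closedBall (0 : ℂ) 1) :=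
    isCompact_univ_pi fun _ => isCompact_univ_pi fun _ => isCompact_closedBall _ _
  refine IsCompact.of_isClosed_subset hK ?_ ?_
  · have : (Matrix.unitaryGroup (Fin d) ℂ : Set (Matrix (Fin d) (Fin d) ℂ)) =
        {U | U * Uᴴ = 1} := by
      ext U; exact Matrix.mem_unitaryGroup_iff
    rw [this]
    exact isClosed_eq (continuous_id.matrix_mul continuous_id.matrix_conjTranspose)
      continuous_const
  · intro U hU i _ j _
    rw [mem_closedBall_zero_iff]
    exact entry_norm_bound_of_unitary hU i j

theorem continuous_conj_diagonal (d : ℕ) :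
    Continuous fun p : Matrix (Fin d) (Fin d) ℂ × (Fin d → ℝ) =>
      p.1 * diagonal (fun i => (p.2 i : ℂ)) * p.1ᴴ := by
  refine (continuous_fst.matrix_mul (Continuous.matrix_diagonal ?_)).matrix_mul
    continuous_fst.matrix_conjTranspose
  fun_prop

theorem continuous_conj (d : ℕ) :
    Continuous fun p : Matrix (Fin d) (Fin d) ℂ × Matrix (Fin d) (Fin d) ℂ =>
      p.1ᴴ * p.2 * p.1 :=
  (continuous_fst.matrix_conjTranspose.matrix_mul continuous_snd).matrix_mul continuous_fst

/-- Along an ultrafilter, ordered eigenbases of a convergent family of matrices converge to an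
ordered eigenbasis of the limit. -/
theorem exists_tendsto_isOrderedEigenbasis {β : Type*} {F : Ultrafilter β} {d : ℕ}
    {A U : β → Matrix (Fin d) (Fin d) ℂ} {μ : β → Fin d → ℝ} {A₀ : Matrix (Fin d) (Fin d) ℂ}
    (hA : Tendsto A F (𝓝 A₀)) (h : ∀ᶠ x in (F : Filter β), IsOrderedEigenbasis (A x) (U x) (μ x)) :
    ∃ U₀ μ₀, IsOrderedEigenbasis A₀ U₀ μ₀ ∧ Tendsto U F (𝓝 U₀) ∧ Tendsto μ F (𝓝 μ₀) := by
  obtain ⟨U₀, hU₀, hU⟩ := isCompact_iff_ultrafilter_le_nhds.1 (isCompact_unitaryGroup d)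
    (F.map U) (le_principal_iff.2 (h.mono fun x hx => hx.1))
  have hU : Tendsto U F (𝓝 U₀) := hU
  -- The eigenvalues are the diagonal entries of `Uᴴ * A * U`, so they converge as soon as `U` and
  -- `A` do.
  have hc := (continuous_conj d).tendsto (U₀, A₀) |>.comp (hU.prodMk_nhds hA)
  have hμ : Tendsto μ F (𝓝 fun i => ((U₀ᴴ * A₀ * U₀) i i).re) := by
    rw [tendsto_pi_nhds]
    intro i
    have h1 : Continuous fun M : Matrix (Fin d) (Fin d) ℂ => (M i i).re :=
      Complex.continuous_re.comp (continuous_id.matrix_elem i i)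
    refine ((h1.tendsto _).comp hc).congr' ?_
    filter_upwards [h] with x hx
    exact (hx.eigenvalue_eq i).symm
  refine ⟨U₀, _, ⟨hU₀, ?_, ?_⟩, hU, hμ⟩
  · intro i j hij
    exact le_of_tendsto_of_tendsto (tendsto_pi_nhds.1 hμ j) (tendsto_pi_nhds.1 hμ i)
      (h.mono fun x hx => hx.2.1 hij)
  · refine tendsto_nhds_unique hA ?_
    refine (((continuous_conj_diagonal d).tendsto (U₀, _)).comp (hU.prodMk_nhds hμ)).congr' ?_
    filter_upwards [h] with x hx
    exact hx.2.2.symm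

/-- Eigenbases and eigenvalues converge along the ultrafilter, and `x ^ s` is continuous at the
positive eigenvalues of `A₀`. -/
theorem tendsto_mpow {β : Type*} {F : Ultrafilter β} {d : ℕ}
    {A : β → Matrix (Fin d) (Fin d) ℂ} {A₀ : Matrix (Fin d) (Fin d) ℂ}
    (hA : Tendsto A F (𝓝 A₀)) (hpd : ∀ᶠ x in (F : Filter β), (A x).PosDef) (hA₀ : A₀.PosDef)
    (s : ℝ) : Tendsto (fun x => mpow (A x) s) F (𝓝 (mpow A₀ s)) := by
  have : ∀ x, ∃ U μ, (A x).PosDef → IsOrderedEigenbasis (A x) U μ := by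
    intro x
    by_cases h : (A x).PosDef
    · obtain ⟨U, μ, hU⟩ := exists_isOrderedEigenbasis h.1
      exact ⟨U, μ, fun _ => hU⟩
    · exact ⟨0, 0, fun h' => absurd h' h⟩
  choose U μ hUμ using this
  have hev := hpd.mono fun x hx => hUμ x hx
  obtain ⟨U₀, μ₀, h₀, hU, hμ⟩ := exists_tendsto_isOrderedEigenbasis hA hev
  have hμs : Tendsto (fun x i => μ x i ^ s) F (𝓝 fun i => μ₀ i ^ s) := by
    rw [tendsto_pi_nhds]
    intro i
    exact (tendsto_pi_nhds.1 hμ i).rpow_const (Or.inl (h₀.pos hA₀ i).ne')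
  rw [mpow, h₀.cfc_eq]
  refine (((continuous_conj_diagonal d).tendsto (U₀, fun i => μ₀ i ^ s)).comp
    (hU.prodMk_nhds hμs)).congr' ?_
  filter_upwards [hev] with x hx
  rw [mpow, hx.cfc_eq]
  rfl

theorem continuous_leadingMinor (d k : ℕ) :
    Continuous fun p : Matrix (Fin d) (Fin d) ℂ × Matrix (Fin d) (Fin d) ℂ =>
      leadingMinor p.1 p.2 k :=
  Complex.continuous_re.comp ((continuous_conj d).matrix_submatrix _ _).matrix_det

/-- A function given by the limit formula in every ordered eigenbasis is jointly continuous. -/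
theorem continuousOn_of_eq_limitFormula {n : ℕ} {r : ℝ}
    {L : Matrix (Fin (n + 1)) (Fin (n + 1)) ℂ → Matrix (Fin (n + 1)) (Fin (n + 1)) ℂ → ℝ}
    (hL : ∀ ρ σ : Matrix (Fin (n + 1)) (Fin (n + 1)) ℂ, ρ.PosSemidef → ρ ≠ 0 → σ.PosDef →
      ∀ (U : Matrix (Fin (n + 1)) (Fin (n + 1)) ℂ) (μ : Fin (n + 1) → ℝ),
        IsOrderedEigenbasis ρ U μ → L ρ σ = limitFormula ρ σ μ (nu r U σ) / ρ.trace.re) :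
    ContinuousOn (fun p : Matrix (Fin (n + 1)) (Fin (n + 1)) ℂ ×
      Matrix (Fin (n + 1)) (Fin (n + 1)) ℂ => L p.1 p.2)
      {p | p.1.PosSemidef ∧ p.1 ≠ 0 ∧ p.2.PosDef} := by
  intro p hp
  set S := {p : Matrix (Fin (n + 1)) (Fin (n + 1)) ℂ × Matrix (Fin (n + 1)) (Fin (n + 1)) ℂ |
    p.1.PosSemidef ∧ p.1 ≠ 0 ∧ p.2.PosDef} with hS
  -- Eigenbases cannot be chosen continuously at degeneracies. Along an ultrafilter any choice
  -- converges to some ordered eigenbasis of the limit, and the formula is valid there.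
  refine (tendsto_iff_ultrafilter _ _ _).2 fun F hF => ?_
  have hFS : ∀ᶠ x in (F : Filter _), x ∈ S := hF self_mem_nhdsWithin
  have hFp : Tendsto (fun x => x) (F : Filter _) (𝓝 p) := hF.trans nhdsWithin_le_nhds
  have h1 : Tendsto (fun x : Matrix (Fin (n + 1)) (Fin (n + 1)) ℂ ×
      Matrix (Fin (n + 1)) (Fin (n + 1)) ℂ => x.1) F (𝓝 p.1) := (continuous_fst.tendsto p).comp hFp
  have h2 : Tendsto (fun x : Matrix (Fin (n + 1)) (Fin (n + 1)) ℂ ×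
      Matrix (Fin (n + 1)) (Fin (n + 1)) ℂ => x.2) F (𝓝 p.2) := (continuous_snd.tendsto p).comp hFp
  have : ∀ x : Matrix (Fin (n + 1)) (Fin (n + 1)) ℂ × Matrix (Fin (n + 1)) (Fin (n + 1)) ℂ,
      ∃ U μ, x ∈ S → IsOrderedEigenbasis x.1 U μ := by
    intro x
    by_cases h : x ∈ S
    · obtain ⟨U, μ, hU⟩ := exists_isOrderedEigenbasis h.1.1
      exact ⟨U, μ, fun _ => hU⟩
    · exact ⟨0, 0, fun h' => absurd h' h⟩
  choose U μ hUμ using this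
  have hev := hFS.mono fun x hx => hUμ x hx
  obtain ⟨U₀, μ₀, h₀, hU, hμ⟩ := exists_tendsto_isOrderedEigenbasis h1 hev
  have hμi := tendsto_pi_nhds.1 hμ
  have hpow := tendsto_mpow h2 (hFS.mono fun x hx => hx.2.2) hp.2.2 (-1 / r)
  have hν : ∀ k, Tendsto (fun x => Real.logb 2 (nu r (U x) x.2 k)) F
      (𝓝 (Real.logb 2 (nu r U₀ p.2 k))) := by
    intro k
    have hm := ((continuous_leadingMinor (n + 1) k).tendsto (U₀, mpow p.2 (-1 / r))).comp
      (hU.prodMk_nhds hpow)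
    exact ((hm.rpow_const (p := -r) (Or.inl (leadingMinor_pos (posDef_mpow hp.2.2 _) h₀.1 k).ne')).log
      (nu_pos hp.2.2 h₀.1 r k).ne').div_const _
  have hent : Tendsto (fun x => ∑ i, μ x i * Real.logb 2 (μ x i)) F
      (𝓝 (∑ i, μ₀ i * Real.logb 2 (μ₀ i))) := by
    refine tendsto_finsetSum _ fun i _ => ?_
    -- Continuity of `x * log x` at `0` covers singular `ρ`.
    have := ((Real.continuous_mul_log.tendsto (μ₀ i)).comp (hμi i)).div_const (Real.log 2)
    simpa only [Real.logb, mul_div_assoc, Function.comp_def] using this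
  have hdet : Tendsto (fun x : Matrix (Fin (n + 1)) (Fin (n + 1)) ℂ ×
      Matrix (Fin (n + 1)) (Fin (n + 1)) ℂ => Real.logb 2 x.2.det.re) F
      (𝓝 (Real.logb 2 p.2.det.re)) :=
    (((Complex.continuous_re.comp continuous_id.matrix_det).tendsto _).comp h2 |>.log
      (Complex.lt_def.1 hp.2.2.det_pos).1.ne').div_const _
  have htr : Tendsto (fun x : Matrix (Fin (n + 1)) (Fin (n + 1)) ℂ ×
      Matrix (Fin (n + 1)) (Fin (n + 1)) ℂ => x.1.trace.re) F (𝓝 p.1.trace.re) :=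
    ((Complex.continuous_re.comp continuous_id.matrix_trace).tendsto _).comp h1
  have hlim := ((hent.sub ((hμi (Fin.last n)).mul hdet)).sub
    (tendsto_finsetSum Finset.univ fun i : Fin n => fun _ =>
      ((hμi i.castSucc).sub (hμi i.succ)).mul (hν ((i : ℕ) + 1)))).div htr
      (trace_pos hp.1 hp.2.1).ne'
  have hform : ∀ x ∈ S, ∀ U μ, IsOrderedEigenbasis x.1 U μ → L x.1 x.2 =
      ((∑ i, μ i * Real.logb 2 (μ i)) - μ (Fin.last n) * Real.logb 2 x.2.det.re -
        ∑ i : Fin n, (μ i.castSucc - μ i.succ) * Real.logb 2 (nu r U x.2 ((i : ℕ) + 1))) /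
        x.1.trace.re := by
    intro x hx U μ h
    rw [hL _ _ hx.1 hx.2.1 hx.2.2 U μ h, limitFormula, vonNeumannEntropy_eq h, neg_neg]
  change Tendsto _ _ (𝓝 (L p.1 p.2))
  rw [hform p hp U₀ μ₀ h₀]
  refine hlim.congr' ?_
  filter_upwards [hFS] with x hx
  exact (hform x hx _ _ (hUμ x hx)).symm

/-! ### Failure of differentiability at an eigenvalue crossing -/

theorem leadingMinor_eq_castLE {d k : ℕ} (hk : k ≤ d) (U A : Matrix (Fin d) (Fin d) ℂ) :
    leadingMinor U A k =
      ((Uᴴ * A * U).submatrix (Fin.castLE hk) (Fin.castLE hk)).det.re := by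
  let e : Fin k ≃ {j : Fin d // (j : ℕ) < k} :=
    { toFun := fun i => ⟨Fin.castLE hk i, i.2⟩
      invFun := fun j => ⟨j.1, j.2⟩
      left_inv := fun i => rfl
      right_inv := fun j => rfl }
  exact congrArg Complex.re (Matrix.det_submatrix_equiv_self e
    ((Uᴴ * A * U).submatrix Subtype.val Subtype.val)).symm

/-- The sum of the identity and the matrix all of whose entries are `1`. -/
def oneAddOnes (d : ℕ) : Matrix (Fin d) (Fin d) ℂ := 1 + vecMulVec 1 (star 1)

theorem oneAddOnes_apply {d : ℕ} (i j : Fin d) :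
    oneAddOnes d i j = (if i = j then 1 else 0) + 1 := by
  simp [oneAddOnes, vecMulVec, Matrix.one_apply]

theorem posDef_oneAddOnes (d : ℕ) : (oneAddOnes d).PosDef :=
  PosDef.one.add_posSemidef (posSemidef_vecMulVec_self_star 1)

theorem conj_permMatrix {d : ℕ} (e : Equiv.Perm (Fin d)) (A : Matrix (Fin d) (Fin d) ℂ) :
    e.permMatrix ℂ * A * (e.permMatrix ℂ)ᴴ = A.submatrix e e := by
  rw [conjTranspose_permMatrix, PEquiv.toMatrix_toPEquiv_mul, PEquiv.mul_toMatrix_toPEquiv]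
  rfl

theorem permMatrix_mem_unitaryGroup {d : ℕ} (e : Equiv.Perm (Fin d)) :
    e.permMatrix ℂ ∈ Matrix.unitaryGroup (Fin d) ℂ := by
  have h := conj_permMatrix e 1
  rw [Matrix.mul_one, submatrix_one_equiv] at h
  exact Matrix.mem_unitaryGroup_iff.2 h

/-- The matrix is invariant under simultaneous permutation of rows and columns, so reordering the
eigenbasis leaves every `ν_k` unchanged. -/
theorem leadingMinor_oneAddOnes {d : ℕ} (e : Equiv.Perm (Fin d)) (k : ℕ) :
    leadingMinor (e.permMatrix ℂ) (oneAddOnes d) k = leadingMinor 1 (oneAddOnes d) k := by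
  have h1 : (e.permMatrix ℂ)ᴴ * oneAddOnes d * e.permMatrix ℂ = oneAddOnes d := by
    have h := conj_permMatrix e⁻¹ (oneAddOnes d)
    rw [← conjTranspose_permMatrix, conjTranspose_conjTranspose] at h
    rw [h]
    ext i j
    simp [oneAddOnes_apply]
  rw [leadingMinor, h1, leadingMinor]
  simp

theorem leadingMinor_one_oneAddOnes_one (m : ℕ) : leadingMinor 1 (oneAddOnes (m + 2)) 1 = 2 := by
  rw [leadingMinor_eq_castLE (by omega), det_fin_one]
  simp [oneAddOnes_apply]
  norm_num

theorem leadingMinor_one_oneAddOnes_two (m : ℕ) : leadingMinor 1 (oneAddOnes (m + 2)) 2 = 3 := by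
  rw [leadingMinor_eq_castLE (by omega), det_fin_two]
  simp [oneAddOnes_apply, Fin.ext_iff]
  norm_num

/-- The spectrum `(2c, 2c, c, …, c)`. -/
def baseSpectrum (d : ℕ) (c : ℝ) (i : Fin d) : ℝ := if (i : ℕ) ≤ 1 then 2 * c else c

/-- The traceless direction `(1, -1, 0, …, 0)`. -/
def splitDirection (d : ℕ) (i : Fin d) : ℝ :=
  if (i : ℕ) = 0 then 1 else if (i : ℕ) = 1 then -1 else 0

theorem antitone_spectrum {d : ℕ} {c t : ℝ} (ht : 0 ≤ t) (htc : t ≤ c) :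
    Antitone fun i : Fin d => baseSpectrum d c i + t * splitDirection d i := by
  intro i j hij
  have hij : (i : ℕ) ≤ j := hij
  simp only [baseSpectrum, splitDirection]
  split_ifs <;> first | omega | linarith

theorem baseSpectrum_swap {m : ℕ} (c : ℝ) (i : Fin (m + 2)) :
    baseSpectrum (m + 2) c (Equiv.swap 0 1 i) = baseSpectrum (m + 2) c i := by
  rcases eq_or_ne i 0 with rfl | h0
  · simp [baseSpectrum]
  rcases eq_or_ne i 1 with rfl | h1
  · simp [baseSpectrum]
  rw [Equiv.swap_apply_of_ne_of_ne h0 h1]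

theorem splitDirection_swap {m : ℕ} (i : Fin (m + 2)) :
    splitDirection (m + 2) (Equiv.swap 0 1 i) = -splitDirection (m + 2) i := by
  rcases eq_or_ne i 0 with rfl | h0
  · simp [splitDirection]
  rcases eq_or_ne i 1 with rfl | h1
  · simp [splitDirection]
  rw [Equiv.swap_apply_of_ne_of_ne h0 h1]
  have h0' : (i : ℕ) ≠ 0 := fun h => h0 (Fin.ext h)
  have h1' : (i : ℕ) ≠ 1 := fun h => h1 (Fin.ext h)
  simp [splitDirection, h0', h1']

theorem sum_splitDirection_mul (m : ℕ) (f : ℕ → ℝ) :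
    ∑ i, splitDirection (m + 2) i * f i = f 0 - f 1 := by
  rw [Fin.sum_univ_succ, Fin.sum_univ_succ]
  simp [splitDirection]
  ring

/-- The two top eigenvalues `2c ± t` cross at `t = 0`. Since `ν` is insensitive to their exchange,
`L` is a function differentiable at `0` minus `κ * |t|`, where `κ = log (ν_1 ^ 2 / ν_2) = -r * log
(4 / 3)` is nonzero. -/
theorem exists_not_differentiableAt {m : ℕ} {r : ℝ} (hr : r ≠ 0)
    {L : Matrix (Fin (m + 2)) (Fin (m + 2)) ℂ → Matrix (Fin (m + 2)) (Fin (m + 2)) ℂ → ℝ}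
    (hL : ∀ ρ σ : Matrix (Fin (m + 2)) (Fin (m + 2)) ℂ, ρ.PosSemidef → ρ ≠ 0 → σ.PosDef →
      ∀ (U : Matrix (Fin (m + 2)) (Fin (m + 2)) ℂ) (μ : Fin (m + 2) → ℝ),
        IsOrderedEigenbasis ρ U μ →
        L ρ σ = relEntropy ρ (sigmaHat U (nu r U σ)) / ρ.trace.re) :
    ∃ ρ₀ H σ : Matrix (Fin (m + 2)) (Fin (m + 2)) ℂ,
      ρ₀.PosDef ∧ ρ₀.trace = 1 ∧ H.IsHermitian ∧ H.trace = 0 ∧ σ.PosDef ∧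
      ¬ DifferentiableAt ℝ (fun t : ℝ => L (ρ₀ + (t : ℂ) • H) σ) 0 := by
  set c : ℝ := 1 / ∑ i, baseSpectrum (m + 2) 1 i with hcdef
  have hS : 0 < ∑ i, baseSpectrum (m + 2) 1 i :=
    Finset.sum_pos (fun i _ => by unfold baseSpectrum; split_ifs <;> norm_num) ⟨0, by simp⟩
  have hc : 0 < c := one_div_pos.2 hS
  have hsum : ∑ i, baseSpectrum (m + 2) c i = 1 := by
    have : ∀ i, baseSpectrum (m + 2) c i = c * baseSpectrum (m + 2) 1 i := fun i => by
      unfold baseSpectrum; split_ifs <;> ring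
    rw [Finset.sum_congr rfl fun i _ => this i, ← Finset.mul_sum, hcdef, one_div,
      inv_mul_cancel₀ hS.ne']
  have hsplit : ∑ i, splitDirection (m + 2) i = 0 := by
    simpa using sum_splitDirection_mul m fun _ => 1
  have hbase : ∀ i, c ≤ baseSpectrum (m + 2) c i := fun i => by
    unfold baseSpectrum; split_ifs <;> linarith
  have hsplit1 : ∀ i, |splitDirection (m + 2) i| ≤ 1 := fun i => by
    unfold splitDirection; split_ifs <;> norm_num
  set ρ : ℝ → Matrix (Fin (m + 2)) (Fin (m + 2)) ℂ := fun t =>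
    diagonal fun i => ((baseSpectrum (m + 2) c i + t * splitDirection (m + 2) i : ℝ) : ℂ) with hρ
  set H : Matrix (Fin (m + 2)) (Fin (m + 2)) ℂ :=
    diagonal fun i => (splitDirection (m + 2) i : ℂ) with hH
  -- Chosen so that `σ ^ (-1/r)` is `oneAddOnes`, whatever `r` is.
  set σ := mpow (oneAddOnes (m + 2)) (-r) with hσdef
  have hσ : σ.PosDef := posDef_mpow (posDef_oneAddOnes _) _
  have hσr : mpow σ (-1 / r) = oneAddOnes (m + 2) := by
    rw [hσdef, mpow_mpow (posDef_oneAddOnes _), show -r * (-1 / r) = 1 by field_simp,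
      mpow_one (posDef_oneAddOnes _).1]
  have hρt : ∀ t : ℝ, ρ 0 + (t : ℂ) • H = ρ t := by
    intro t
    rw [hρ, hH, ← diagonal_smul, diagonal_add]
    congr 1
    ext i
    simp
  have hρpd : ∀ t : ℝ, |t| < c → (ρ t).PosDef := by
    intro t ht
    rw [hρ, posDef_diagonal_iff]
    intro i
    have h1 : |t * splitDirection (m + 2) i| < c := by
      rw [abs_mul]
      exact (mul_le_of_le_one_right (abs_nonneg t) (hsplit1 i)).trans_lt ht
    have : 0 < baseSpectrum (m + 2) c i + t * splitDirection (m + 2) i := by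
      linarith [hbase i, neg_lt_of_abs_lt h1]
    exact_mod_cast this
  have hρtr : ∀ t, (ρ t).trace = 1 := by
    intro t
    rw [hρ, trace_diagonal, ← Complex.ofReal_sum, Finset.sum_add_distrib, ← Finset.mul_sum,
      hsum, hsplit]
    simp
  let ν := nu r 1 σ
  let E : ℝ → ℝ := fun t => ∑ i, (baseSpectrum (m + 2) c i + t * splitDirection (m + 2) i) *
    Real.logb 2 (baseSpectrum (m + 2) c i + t * splitDirection (m + 2) i)
  have hνperm : ∀ e : Equiv.Perm (Fin (m + 2)), nu r (e.permMatrix ℂ) σ = ν := by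
    intro e
    funext k
    simp only [ν, nu, hσr, leadingMinor_oneAddOnes]
  have hνpos : ∀ k, 0 < ν k := nu_pos hσ (one_mem _) r
  -- For negative `t`, swapping the first two basis vectors restores the decreasing order; the
  -- condition `|t| < c` keeps these eigenvalues above the rest.
  have heig : ∀ t : ℝ, |t| < c → ∃ e : Equiv.Perm (Fin (m + 2)),
      IsOrderedEigenbasis (ρ t) (e.permMatrix ℂ)
        (fun i => baseSpectrum (m + 2) c i + |t| * splitDirection (m + 2) i) := by
    intro t ht
    rcases le_total 0 t with h0 | h0
    · refine ⟨1, permMatrix_mem_unitaryGroup _, antitone_spectrum (abs_nonneg t) ht.le, ?_⟩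
      rw [conj_permMatrix, abs_of_nonneg h0]
      rfl
    · refine ⟨Equiv.swap 0 1, permMatrix_mem_unitaryGroup _,
        antitone_spectrum (abs_nonneg t) ht.le, ?_⟩
      rw [conj_permMatrix, abs_of_nonpos h0, submatrix_diagonal_equiv, hρ]
      refine congrArg diagonal (funext fun i => ?_)
      simp [baseSpectrum_swap, splitDirection_swap]
  have hEabs : ∀ t, E |t| = E t := by
    intro t
    rcases le_total 0 t with h0 | h0
    · rw [abs_of_nonneg h0]
    · rw [abs_of_nonpos h0]
      simp only [E]
      rw [← Equiv.sum_comp (Equiv.swap (0 : Fin (m + 2)) 1)]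
      simp only [baseSpectrum_swap, splitDirection_swap, neg_mul_neg]
  set κ := 2 * Real.logb 2 (ν 1) - Real.logb 2 (ν 2) with hκdef
  have hκ : κ ≠ 0 := by
    have h1 : κ = -r * ((Real.log 4 - Real.log 3) / Real.log 2) := by
      rw [hκdef, logb_nu hσ (one_mem _), logb_nu hσ (one_mem _), hσr,
        leadingMinor_one_oneAddOnes_one, leadingMinor_one_oneAddOnes_two,
        show (4 : ℝ) = 2 ^ 2 by norm_num, Real.log_pow, Real.logb, Real.logb]
      push_cast
      ring
    rw [h1]
    have h2 : Real.log 3 < Real.log 4 := Real.log_lt_log (by norm_num) (by norm_num)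
    exact mul_ne_zero (neg_ne_zero.2 hr)
      (div_pos (sub_pos.2 h2) (Real.log_pos (by norm_num))).ne'
  set K := ∑ i : Fin (m + 2), baseSpectrum (m + 2) c i *
    (Real.logb 2 (ν ((i : ℕ) + 1)) - Real.logb 2 (ν i)) with hK
  have hLt : ∀ t : ℝ, |t| < c → L (ρ 0 + (t : ℂ) • H) σ = E t - (K + |t| * κ) := by
    intro t ht
    obtain ⟨e, he⟩ := heig t ht
    have hpd := hρpd t ht
    have hne : ρ t ≠ 0 := fun h => by
      have := hρtr t
      simp [h] at this
    rw [hρt, hL _ _ hpd.posSemidef hne hσ _ _ he, hνperm, relEntropy_sigmaHat he hνpos, hρtr,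
      Complex.one_re, div_one, ← hEabs]
    congr 1
    have h0 : ν 0 = 1 := nu_zero _ _ _
    have h1 := sum_splitDirection_mul m fun k => Real.logb 2 (ν (k + 1)) - Real.logb 2 (ν k)
    simp only [h0, Real.logb_one, zero_add, sub_zero] at h1
    have h2 : κ = ∑ i, splitDirection (m + 2) i *
        (Real.logb 2 (ν ((i : ℕ) + 1)) - Real.logb 2 (ν i)) := by
      rw [h1, hκdef]; ring
    rw [h2, hK, Finset.mul_sum, ← Finset.sum_add_distrib]
    exact Finset.sum_congr rfl fun i _ => by ring
  have hEd : DifferentiableAt ℝ E 0 := by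
    refine DifferentiableAt.fun_sum fun i _ => ?_
    have hne : baseSpectrum (m + 2) c i + 0 * splitDirection (m + 2) i ≠ 0 := by
      rw [zero_mul, add_zero]; exact (hc.trans_le (hbase i)).ne'
    have hlin : DifferentiableAt ℝ
        (fun t : ℝ => baseSpectrum (m + 2) c i + t * splitDirection (m + 2) i) 0 := by fun_prop
    exact hlin.mul ((hlin.log hne).div_const _)
  refine ⟨ρ 0, H, σ, hρpd 0 (by simpa using hc), hρtr 0, ?_, ?_, hσ, fun hd => ?_⟩
  · exact isHermitian_diagonal_iff.2 fun i => Complex.conj_ofReal _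
  · rw [hH, trace_diagonal, ← Complex.ofReal_sum, hsplit, Complex.ofReal_zero]
  · refine not_differentiableAt_abs_zero ?_
    -- Near `0`, `|t| = (E t - L - K) / κ`, so differentiability of `L` would pass to `|t|`.
    have h1 := ((hEd.sub hd).sub_const K).div_const κ
    refine h1.congr_of_eventuallyEq ?_
    have hball : ∀ᶠ t : ℝ in 𝓝 0, |t| < c := by
      have := (continuous_abs.tendsto (0 : ℝ))
      rw [abs_zero] at this
      exact this.eventually_lt_const hc
    filter_upwards [hball] with t ht
    simp only [Pi.sub_apply]
    rw [hLt t ht]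
    field_simp
    ring

/-! ### The one-sided limit, the case `r = -1`, and the main theorem -/

/-- Needed for uniqueness of the limit, which makes `L` agree with the formula in every ordered
eigenbasis. -/
theorem neBot_nhdsWithin_one {r : ℝ} (hr : r ≠ 0) :
    (𝓝[{α : ℝ | 0 < r * (α - 1)}] 1).NeBot := by
  rcases lt_or_gt_of_ne hr with h | h
  · have : {α : ℝ | 0 < r * (α - 1)} = Set.Iio 1 := by
      ext α
      simp only [Set.mem_ofPred_eq, Set.mem_Iio, mul_pos_iff, h, not_lt.2 h.le, false_and, true_and,
        false_or, sub_neg]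
    rw [this]; infer_instance
  · have : {α : ℝ | 0 < r * (α - 1)} = Set.Ioi 1 := by
      ext α
      simp [mul_pos_iff_of_pos_left h]
    rw [this]; infer_instance

theorem tendsto_reverseSandwiched {n : ℕ} {ρ σ U : Matrix (Fin (n + 1)) (Fin (n + 1)) ℂ}
    {μ : Fin (n + 1) → ℝ} (hρ : ρ.PosSemidef) (h0 : ρ ≠ 0) (hσ : σ.PosDef)
    (h : IsOrderedEigenbasis ρ U μ) :
    Tendsto (fun α : ℝ => reverseSandwiched α ρ σ) (𝓝[<] 1)
      (𝓝 (limitFormula ρ σ μ (leadingMinor U σ) / ρ.trace.re)) := by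
  have hlim := tendsto_renyi (r := -1) (by norm_num) hρ h0 hσ h
  have hS : {α : ℝ | 0 < -1 * (α - 1)} = Set.Iio 1 := by
    ext α
    simp
  have hν : nu (-1) U σ = leadingMinor U σ := by
    funext k
    rw [nu, neg_neg, Real.rpow_one, neg_div_neg_eq, div_one, mpow_one hσ.1]
  rw [hS, hν] at hlim
  refine hlim.congr' ?_
  filter_upwards [self_mem_nhdsWithin] with α hα
  have hα : α < 1 := hα
  have hz : -1 * (α - 1) = 1 - α := by ring
  rw [renyi, reverseSandwiched, traceFunctional, hz, div_self (sub_pos.2 hα).ne', mpow_one hσ.1]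

end RenyiLimit

theorem mainTheorem4 (n : ℕ) (r : ℝ) (hr : r ≠ 0) :
    (∃ L : Matrix (Fin (n + 1)) (Fin (n + 1)) ℂ → Matrix (Fin (n + 1)) (Fin (n + 1)) ℂ → ℝ,
      -- existence of the limit, along `z = r (α - 1) > 0`
      (∀ ρ σ : Matrix (Fin (n + 1)) (Fin (n + 1)) ℂ, ρ.PosSemidef → ρ ≠ 0 → σ.PosDef →
        Tendsto (fun α : ℝ => RenyiLimit.renyi α (r * (α - 1)) ρ σ)
          (𝓝[{α : ℝ | 0 < r * (α - 1)}] 1) (𝓝 (L ρ σ))) ∧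
      -- its value, for every choice of an ordered eigenbasis
      (∀ ρ σ : Matrix (Fin (n + 1)) (Fin (n + 1)) ℂ, ρ.PosSemidef → ρ ≠ 0 → σ.PosDef →
        ∀ (U : Matrix (Fin (n + 1)) (Fin (n + 1)) ℂ) (μ : Fin (n + 1) → ℝ),
          RenyiLimit.IsOrderedEigenbasis ρ U μ →
          L ρ σ = RenyiLimit.limitFormula ρ σ μ (RenyiLimit.nu r U σ) / ρ.trace.re ∧
          L ρ σ = RenyiLimit.relEntropy ρ
            (RenyiLimit.sigmaHat U (RenyiLimit.nu r U σ)) / ρ.trace.re) ∧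
      -- joint continuity
      ContinuousOn (fun p : Matrix (Fin (n + 1)) (Fin (n + 1)) ℂ ×
          Matrix (Fin (n + 1)) (Fin (n + 1)) ℂ => L p.1 p.2)
        {p | p.1.PosSemidef ∧ p.1 ≠ 0 ∧ p.2.PosDef} ∧
      -- failure of smoothness in dimension at least two, along a line through an
      -- invertible density matrix
      (1 ≤ n → ∃ ρ₀ H σ : Matrix (Fin (n + 1)) (Fin (n + 1)) ℂ,
        ρ₀.PosDef ∧ ρ₀.trace = 1 ∧ H.IsHermitian ∧ H.trace = 0 ∧ σ.PosDef ∧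
        ¬ DifferentiableAt ℝ (fun t : ℝ => L (ρ₀ + (t : ℂ) • H) σ) 0)) ∧
    -- the special case of the reverse sandwiched entropy (`r = -1`)
    (∀ ρ σ : Matrix (Fin (n + 1)) (Fin (n + 1)) ℂ, ρ.PosSemidef → ρ ≠ 0 → σ.PosDef →
      ∀ (U : Matrix (Fin (n + 1)) (Fin (n + 1)) ℂ) (μ : Fin (n + 1) → ℝ),
        RenyiLimit.IsOrderedEigenbasis ρ U μ →
        Tendsto (fun α : ℝ => RenyiLimit.reverseSandwiched α ρ σ) (𝓝[<] 1)
          (𝓝 (RenyiLimit.limitFormula ρ σ μ (RenyiLimit.leadingMinor U σ) / ρ.trace.re))) := by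
  refine ⟨?_, fun ρ σ hρ h0 hσ U μ h => RenyiLimit.tendsto_reverseSandwiched hρ h0 hσ h⟩
  -- The hypotheses sit inside the existential so that choice yields a total function; outside the
  -- domain the value is arbitrary.
  have hex : ∀ ρ σ : Matrix (Fin (n + 1)) (Fin (n + 1)) ℂ, ∃ x : ℝ,
      ρ.PosSemidef → ρ ≠ 0 → σ.PosDef →
        Tendsto (fun α : ℝ => RenyiLimit.renyi α (r * (α - 1)) ρ σ)
          (𝓝[{α : ℝ | 0 < r * (α - 1)}] 1) (𝓝 x) := by
    intro ρ σ
    by_cases hc : ρ.PosSemidef ∧ ρ ≠ 0 ∧ σ.PosDef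
    · obtain ⟨U, μ, h⟩ := RenyiLimit.exists_isOrderedEigenbasis hc.1.1
      exact ⟨_, fun hρ h0 hσ => RenyiLimit.tendsto_renyi hr hρ h0 hσ h⟩
    · exact ⟨0, fun h1 h2 h3 => absurd ⟨h1, h2, h3⟩ hc⟩
  choose L hL using hex
  have := RenyiLimit.neBot_nhdsWithin_one hr
  have hval : ∀ ρ σ : Matrix (Fin (n + 1)) (Fin (n + 1)) ℂ, ρ.PosSemidef → ρ ≠ 0 → σ.PosDef →
      ∀ (U : Matrix (Fin (n + 1)) (Fin (n + 1)) ℂ) (μ : Fin (n + 1) → ℝ),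
        RenyiLimit.IsOrderedEigenbasis ρ U μ →
        L ρ σ = RenyiLimit.limitFormula ρ σ μ (RenyiLimit.nu r U σ) / ρ.trace.re :=
    fun ρ σ hρ h0 hσ U μ h =>
      tendsto_nhds_unique (hL ρ σ hρ h0 hσ) (RenyiLimit.tendsto_renyi hr hρ h0 hσ h)
  have hval' : ∀ ρ σ : Matrix (Fin (n + 1)) (Fin (n + 1)) ℂ, ρ.PosSemidef → ρ ≠ 0 → σ.PosDef →
      ∀ (U : Matrix (Fin (n + 1)) (Fin (n + 1)) ℂ) (μ : Fin (n + 1) → ℝ),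
        RenyiLimit.IsOrderedEigenbasis ρ U μ →
        L ρ σ = RenyiLimit.relEntropy ρ
          (RenyiLimit.sigmaHat U (RenyiLimit.nu r U σ)) / ρ.trace.re :=
    fun ρ σ hρ h0 hσ U μ h => by
      rw [hval ρ σ hρ h0 hσ U μ h, RenyiLimit.limitFormula_eq_relEntropy hr hσ h]
  refine ⟨L, hL, fun ρ σ hρ h0 hσ U μ h => ⟨hval ρ σ hρ h0 hσ U μ h, hval' ρ σ hρ h0 hσ U μ h⟩,
    RenyiLimit.continuousOn_of_eq_limitFormula hval, fun hn => ?_⟩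
  obtain ⟨m, rfl⟩ : ∃ m, n = m + 1 := ⟨n - 1, by omega⟩
  exact RenyiLimit.exists_not_differentiableAt hr hval'
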